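/- **Theorem.** Let $p$ be a prime and $n\ge 0$. *The group.* Let $G$ be a group of order $p^n$ with a chain of normal subgroups $\{1\}=G_{(n)}<G_{(n-1)}<\dots<G_{(1)}<G_{(0)}=G$ such that $|G_{(i)}|=p^{n-i}$ (a $p$-filtered group), and let $\Sigma_G$ be the set of $1\le i\le n$ such that the extension $G/G_{(i)}$ of $G/G_{(i-1)}$ by $G_{(i-1)}/G_{(i)}$ is split. *The polynomials.* For $1\le i\le n$ let $D_i\in\mathbb F_p[Y_1,\dots,Y_{i-1}]$. For $0\le i\le n$ put $S_i=\mathbb F_p[Y_1,\dots,Y_i]$ and let $R_i=\mathbb F_p[X_1,\dots,X_i]\subseteq S_i$, where $X_j=Y_j^p-Y_j-D_j$. Let $\mathrm{Gal}(S_i/R_i)$ be the group of $R_i$-automorphisms of $S_i$. Suppose that: * $D_i=0$ for $i\in\Sigma_G$, and $D_i\notin\mathbb F_p$ for $i\notin\Sigma_G$; * each $S_i/R_i$ is a Galois extension of rings, that is, $\mathrm{Gal}(S_i/R_i)$ is finite with ring of invariants $R_i$, and for every maximal ideal $M$ of $S_i$ and every $1\ne\sigma\in\mathrm{Gal}(S_i/R_i)$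 there is $s\in S_i$ with $\sigma(s)-s\notin M$; * there are isomorphisms $\lambda_i:\mathrm{Gal}(S_i/R_i)\to G/G_{(i)}$ for $0\le i\le n$ such that, for $1\le i\le n$, every $\sigma\in\mathrm{Gal}(S_i/R_i)$ restricts to an element of $\mathrm{Gal}(S_{i-1}/R_{i-1})$, and $\lambda_{i-1}(\sigma|_{S_{i-1}})$ is the image of $\lambda_i(\sigma)$ in $G/G_{(i-1)}$. *The field extension.* Let $K$ be a local field of characteristic $p$ with perfect residue field, i.e. a field complete with respect to a normalized discrete valuation $v_K$ and with perfect residue field. Extend $v_K$ to a separable closure $K^{sep}$ of $K$. Let $u_1<u_2<\dots<u_n$ be positive integers with $p\nmid u_i$, and let $a_1,\dots,a_n\in K$ satisfy $v_K(a_i)=-u_i$. Let $\alpha_1,\dots,\alpha_n\in K^{sep}$ satisfy $$\alpha_i^p-\alpha_i=d_i+a_i,\qquad d_i=D_i(\alpha_1,\dots,\alpha_{i-1}),$$ and put $K_0=K$, $K_i=K_{i-1}(\alpha_i)$. Define $b_1,\dots,b_n$ by $b_1=u_1$ and $b_{i+1}-b_i=p^i(u_{i+1}-u_i)$ for $1\le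 i\le n-1$. If $b_i>-p^{i-1}v_K(d_i)$ for all $i\notin\Sigma_G$, then the following hold. (a) $K_n/K$ is Galois, and there is an isomorphism $\mu:\mathrm{Gal}(K_n/K)\to G$ such that $\mu(\mathrm{Gal}(K_n/K_i))=G_{(i)}$ for $0\le i\le n$. (b) The upper ramification breaks of $K_n/K$ are exactly $u_1,\dots,u_n$ and its lower ramification breaks are exactly $b_1,\dots,b_n$. Furthermore $v_K(\alpha_i)=-u_i/p$ for $1\le i\le n$. (c) The ramification subgroups of $\mathrm{Gal}(K_n/K)$ (in the lower numbering, and likewise in the upper numbering) are exactly the subgroups $\mathrm{Gal}(K_n/K_i)$ for $0\le i\le n$. -/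

import Mathlib

open scoped WithZero

noncomputable section

/-! ### Filtered `p`-groups -/

/-- A `p`-filtered group: a group `G` of order `p ^ n` with a chain of normal subgroups
`1 = G_(n) < ⋯ < G_(1) < G_(0) = G` such that `|G_(i)| = p ^ (n - i)`. -/
structure PFilteredGroup (p n : ℕ) (G : Type*) [Group G] where
  sub : Fin (n + 1) → Subgroup G
  normal : ∀ i, (sub i).Normal
  sub_zero : sub 0 = ⊤
  sub_last : sub (Fin.last n) = ⊥
  strictAnti : StrictAnti sub
  card_sub : ∀ i, Nat.card (sub i) = p ^ (n - (i : ℕ))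

namespace PFilteredGroup

variable {p n : ℕ} {G : Type*} [Group G] (F : PFilteredGroup p n G)

instance instNormalSub (i : Fin (n + 1)) : (F.sub i).Normal := F.normal i

/-- The projection `G / G_(i+1) → G / G_(i)`, for `0 ≤ i < n`. -/
def proj (i : Fin n) : G ⧸ F.sub i.succ →* G ⧸ F.sub i.castSucc :=
  QuotientGroup.map (F.sub i.succ) (F.sub i.castSucc) (MonoidHom.id G)
    (by
      rw [Subgroup.comap_id]
      exact F.strictAnti.antitone (Fin.castSucc_lt_succ (i := i)).le)

/-- The set `Σ_G` of split indices.  Indices are shifted by one: `i : Fin n` belongs to the set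
if the extension `G / G_(i+1)` of `G / G_(i)` by `G_(i) / G_(i+1)` is split. -/
def splitIndices : Set (Fin n) :=
  {i | ∃ s : G ⧸ F.sub i.castSucc →* G ⧸ F.sub i.succ, (F.proj i).comp s = MonoidHom.id _}

end PFilteredGroup

/-! ### Generic extensions of polynomial rings -/

/-- The ring extension `S / R` is Galois with group the group of all `R`-automorphisms of `S`:
this group is finite, its ring of invariants is `R`, and for every maximal ideal `M` of `S` and
every `σ ≠ 1` there is `s` with `σ s - s ∉ M`.  (If `S` is a domain, no other group of
automorphisms can make `S / R` Galois.) -/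
structure IsGaloisRingExtension (R S : Type*) [CommRing R] [CommRing S] [Algebra R S] : Prop where
  finite : Finite (S ≃ₐ[R] S)
  invariants : ∀ x : S, (∀ σ : S ≃ₐ[R] S, σ x = x) → x ∈ Set.range (algebraMap R S)
  separated : ∀ M : Ideal S, M.IsMaximal → ∀ σ : S ≃ₐ[R] S, σ ≠ 1 → ∃ s : S, σ s - s ∉ M

section Generic

variable {p n : ℕ}

/-- The element `X_j = Y_j ^ p - Y_j - D_j` of `S_i = 𝔽_p[Y_1, …, Y_i]`. Indices are shifted by
one: the variables of `S_i` are indexed by `Fin i`, and `D j` is a polynomial in the variables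
preceding the `j`-th one. -/
def genericX (D : (i : Fin n) → MvPolynomial (Fin i) (ZMod p)) (i : Fin (n + 1)) (j : Fin i) :
    MvPolynomial (Fin i) (ZMod p) :=
  MvPolynomial.X j ^ p - MvPolynomial.X j -
    MvPolynomial.rename (Fin.castLE j.isLt.le) (D (Fin.castLE (Nat.le_of_lt_succ i.isLt) j))

/-- The subring `R_i = 𝔽_p[X_1, …, X_i]` of `S_i = 𝔽_p[Y_1, …, Y_i]`. -/
def genericBase (D : (i : Fin n) → MvPolynomial (Fin i) (ZMod p)) (i : Fin (n + 1)) :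
    Subalgebra (ZMod p) (MvPolynomial (Fin i) (ZMod p)) :=
  Algebra.adjoin (ZMod p) (Set.range (genericX D i))

/-- `Gal(S_i / R_i)`, the group of all `R_i`-automorphisms of `S_i`. -/
abbrev GenericGal (D : (i : Fin n) → MvPolynomial (Fin i) (ZMod p)) (i : Fin (n + 1)) : Type :=
  MvPolynomial (Fin i) (ZMod p) ≃ₐ[genericBase D i] MvPolynomial (Fin i) (ZMod p)

/-- The inclusion `S_i ⊆ S_(i+1)`. -/
def genericIncl (i : Fin n) :
    MvPolynomial (Fin i.castSucc) (ZMod p) →ₐ[ZMod p] MvPolynomial (Fin i.succ) (ZMod p) :=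
  MvPolynomial.rename (Fin.castLE (Nat.le_succ i))

/-- The polynomials `D_i ∈ 𝔽_p[Y_1, …, Y_(i-1)]` define a generic extension for the `p`-filtered
group:
* `D_i = 0` at split indices, and `D_i` is not constant at the other ones;
* every `S_i / R_i` is a Galois extension;
* there are isomorphisms `Gal(S_i / R_i) ≃ G / G_(i)` that are compatible with restriction
  `Gal(S_(i+1) / R_(i+1)) → Gal(S_i / R_i)` and with the projections `G / G_(i+1) → G / G_(i)`. -/
structure IsGenericFamily {G : Type*} [Group G] (F : PFilteredGroup p n G)
    (D : (i : Fin n) → MvPolynomial (Fin i) (ZMod p)) : Prop where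
  eq_zero : ∀ i ∈ F.splitIndices, D i = 0
  not_const : ∀ i ∉ F.splitIndices, D i ∉ Set.range MvPolynomial.C
  galois : ∀ i : Fin (n + 1),
    IsGaloisRingExtension (genericBase D i) (MvPolynomial (Fin i) (ZMod p))
  compatible : ∃ iso : (i : Fin (n + 1)) → (GenericGal D i ≃* G ⧸ F.sub i),
    ∀ (i : Fin n) (σ : GenericGal D i.succ), ∃ τ : GenericGal D i.castSucc,
      (∀ s, σ (genericIncl i s) = genericIncl i (τ s)) ∧
        F.proj i (iso i.succ σ) = iso i.castSucc τ

end Generic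

/-! ### Local fields -/

/-- A local field with perfect residue field: `K` is complete for a normalized (i.e. surjective)
discrete valuation `Valued.v : K → ℤᵐ⁰`, and its residue field is perfect. -/
class IsLocalFieldPerfectResidue (K : Type*) [Field K] [Valued K ℤᵐ⁰] : Prop where
  complete : CompleteSpace K
  normalized : Function.Surjective (Valued.v : K → ℤᵐ⁰)
  perfect : PerfectField (Valued.ResidueField K)

section Valuation

variable (K : Type*) [Field K] [Valued K ℤᵐ⁰] {Ω : Type*} [Field Ω] [Algebra K Ω]

/-- The value at `x` of the extension of the additive valuation `v_K = - log Valued.v` to an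
algebraic extension of `K`: this is `v_K (N x) / [K(x) : K]`, where `N` is the norm of
`K(x) / K`, so that `N x` is, up to sign, the constant coefficient of the minimal polynomial. -/
def extOrd (x : Ω) : WithTop ℝ :=
  open scoped Classical in
  if x = 0 then ⊤
  else ((-((WithZero.log (Valued.v ((minpoly K x).coeff 0)) : ℤ) : ℝ) /
    ((minpoly K x).natDegree : ℝ) : ℝ) : WithTop ℝ)

/-- Comparison with the spectral norm for the absolute value `2 ^ (- v_K)`. -/
theorem exists_absoluteValue_extOrd [IsLocalFieldPerfectResidue K] [Algebra.IsAlgebraic K Ω] :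
    ∃ f : Ω → ℝ, (∀ x, x ≠ 0 → 0 < f x) ∧ f 0 = 0 ∧ (∀ x y, f (x * y) = f x * f y) ∧
      (∀ x y, f (x + y) ≤ max (f x) (f y)) ∧
      ∀ x, x ≠ 0 → extOrd K x = ((-Real.logb 2 (f x) : ℝ) : WithTop ℝ) := by
  have hnt : ∃ x : K, Valued.v x ≠ 0 ∧ Valued.v x ≠ 1 := by
    obtain ⟨x, hx⟩ := IsLocalFieldPerfectResidue.normalized (K := K) (WithZero.exp 1)
    refine ⟨x, by simp [hx], ?_⟩
    rw [hx]
    simp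
  have h2 : (1 : NNReal) < 2 := one_lt_two
  let r : (Valued.v : Valuation K ℤᵐ⁰).RankOne :=
    { hom' := (WithZeroMulInt.toNNReal h2.ne_zero).comp
        MonoidWithZeroHom.ValueGroup₀.embedding
      strictMono' := (WithZeroMulInt.toNNReal_strictMono h2).comp
        MonoidWithZeroHom.ValueGroup₀.embedding_strictMono
      exists_val_nontrivial := hnt }
  let N : NontriviallyNormedField K := Valued.toNontriviallyNormedField (L := K) (Γ₀ := ℤᵐ⁰)
  have hN : ∀ x : K, ‖x‖ = WithZeroMulInt.toNNReal h2.ne_zero (Valued.v x) := by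
    intro x
    have h : MonoidWithZeroHom.ValueGroup₀.embedding ((Valued.v : Valuation K ℤᵐ⁰).restrict x) =
        Valued.v x := Valuation.embedding_restrict _ _
    rw [← h]
    rfl
  have : IsUltrametricDist K := inferInstance
  have hc : CompleteSpace K := IsLocalFieldPerfectResidue.complete
  refine ⟨spectralNorm K Ω, fun x hx => spectralNorm_zero_lt hx (Algebra.IsAlgebraic.isAlgebraic x),
    spectralNorm_zero, fun x y => spectralAlgNorm_mul x y, isNonarchimedean_spectralNorm, ?_⟩
  intro x hx
  have h0 : (minpoly K x).coeff 0 ≠ 0 :=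
    minpoly.coeff_zero_ne_zero (Algebra.IsIntegral.isIntegral x) hx
  have hv : Valued.v ((minpoly K x).coeff 0) ≠ 0 := by simpa using h0
  rw [extOrd, if_neg hx, spectralNorm.spectralNorm_eq_norm_coeff_zero_rpow, hN,
    WithZeroMulInt.toNNReal_neg_apply _ hv, WithZero.toAdd_unzero_eq_log, NNReal.coe_zpow, NNReal.coe_ofNat,
    Real.logb_rpow_eq_mul_logb_of_pos (by positivity),
    ← Real.rpow_intCast, Real.logb_rpow two_pos (by norm_num)]
  congr 1
  ring

/-- The extension of `v_K` to an algebraic extension of `K`, as an additive valuation. -/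
def extVal [IsLocalFieldPerfectResidue K] [Algebra.IsAlgebraic K Ω] :
    AddValuation Ω (WithTop ℝ) :=
  AddValuation.of (extOrd K) (by simp [extOrd]) (by
      simp [extOrd, minpoly.one])
    (by
      intro x y
      obtain ⟨f, hpos, -, -, hadd, hf⟩ := exists_absoluteValue_extOrd K (Ω := Ω)
      rcases eq_or_ne x 0 with rfl | hx
      · simp
      rcases eq_or_ne y 0 with rfl | hy
      · simp
      rcases eq_or_ne (x + y) 0 with hxy | hxy
      · rw [hxy]
        simp [extOrd]
      rw [hf x hx, hf y hy, hf _ hxy, ← WithTop.coe_min, WithTop.coe_le_coe, min_neg_neg,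
        neg_le_neg_iff]
      rcases le_max_iff.mp (hadd x y) with h | h
      · exact le_max_of_le_left (Real.logb_le_logb_of_le one_lt_two (hpos _ hxy) h)
      · exact le_max_of_le_right (Real.logb_le_logb_of_le one_lt_two (hpos _ hxy) h))
    (by
      intro x y
      obtain ⟨f, hpos, -, hmul, -, hf⟩ := exists_absoluteValue_extOrd K (Ω := Ω)
      rcases eq_or_ne x 0 with rfl | hx
      · simp [extOrd]
      rcases eq_or_ne y 0 with rfl | hy
      · simp [extOrd]
      rw [hf x hx, hf y hy, hf _ (mul_ne_zero hx hy), ← WithTop.coe_add, hmul,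
        Real.logb_mul (hpos x hx).ne' (hpos y hy).ne', neg_add])

end Valuation

/-! ### Ramification groups -/

section Ramification

variable {K : Type*} [Field K] [Valued K ℤᵐ⁰] [IsLocalFieldPerfectResidue K]
  {Ω : Type*} [Field Ω] [Algebra K Ω] [Algebra.IsAlgebraic K Ω]

/-- The value group `v_K(Lˣ)`, a subgroup of `ℝ`. -/
def valueGroupOf (L : IntermediateField K Ω) : AddSubgroup ℝ where
  carrier := {r | ∃ x ∈ L, extVal K x = (r : WithTop ℝ)}
  zero_mem' := ⟨1, L.one_mem, by simp⟩
  add_mem' := by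
    rintro a b ⟨x, hx, hxa⟩ ⟨y, hy, hyb⟩
    exact ⟨x * y, L.mul_mem hx hy, by rw [AddValuation.map_mul, hxa, hyb, WithTop.coe_add]⟩
  neg_mem' := by
    rintro a ⟨x, hx, hxa⟩
    refine ⟨x⁻¹, L.inv_mem hx, ?_⟩
    have hx0 : x ≠ 0 := by
      rintro rfl
      simp at hxa
    have h : extVal K x + extVal K x⁻¹ = 0 := by
      rw [← AddValuation.map_mul, mul_inv_cancel₀ hx0, AddValuation.map_one]
    rw [hxa] at h
    cases h' : extVal K x⁻¹ with
    | top => simp [h'] at h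
    | coe r =>
      rw [h'] at h
      have h3 : a + r = 0 := by exact_mod_cast h
      rw [eq_neg_of_add_eq_zero_right h3]

/-- The ramification index `e(L/K) = [v_K(Lˣ) : v_K(Kˣ)]`. -/
def ramIndex (L : IntermediateField K Ω) : ℕ :=
  (valueGroupOf (⊥ : IntermediateField K Ω)).relIndex (valueGroupOf L)

/-- The normalized valuation `v_L = e(L/K) v_K` of a finite extension `L` of `K`, for which
`v_L(Lˣ) = ℤ`. -/
def normVal (L : IntermediateField K Ω) (x : Ω) : WithTop ℝ :=
  (extVal K x).map fun r => (ramIndex L : ℝ) * r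

theorem extVal_algEquiv {L : IntermediateField K Ω} (σ : Gal(L/K)) (x : L) :
    extVal K (σ x : Ω) = extVal K (x : Ω) := by
  have h : minpoly K (σ x : Ω) = minpoly K (x : Ω) := by
    have h1 : minpoly K (σ x : Ω) = minpoly K (σ x) :=
      minpoly.algebraMap_eq (algebraMap L Ω).injective _
    have h2 : minpoly K (x : Ω) = minpoly K x :=
      minpoly.algebraMap_eq (algebraMap L Ω).injective _
    rw [h1, h2, minpoly.algEquiv_eq]
  change extOrd K (σ x : Ω) = extOrd K (x : Ω)
  have h0 : (σ x : Ω) = 0 ↔ (x : Ω) = 0 := by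
    rw [ZeroMemClass.coe_eq_zero, ZeroMemClass.coe_eq_zero, map_eq_zero_iff σ σ.injective]
  by_cases hx : (x : Ω) = 0
  · rw [extOrd, extOrd, if_pos hx, if_pos (h0.mpr hx)]
  · rw [extOrd, extOrd, if_neg hx, if_neg (mt h0.mp hx), h]

theorem le_normVal_add {L : IntermediateField K Ω} {r : WithTop ℝ} {x y : Ω}
    (hx : r ≤ normVal L x) (hy : r ≤ normVal L y) : r ≤ normVal L (x + y) := by
  have hm : Monotone (WithTop.map fun r : ℝ => (ramIndex L : ℝ) * r) :=
    Monotone.withTop_map fun a b h => mul_le_mul_of_nonneg_left h (Nat.cast_nonneg _)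
  rcases min_le_iff.mp (AddValuation.map_add (extVal K) x y) with h | h
  · exact hx.trans (hm h)
  · exact hy.trans (hm h)

/-- The lower ramification group `G_t` of `G = Gal(L/K)`, for `t ≥ -1`: the group of all `σ` such
that `v_L(σ x - x) ≥ t + 1` for every `x` in the ring of integers of `L`. -/
def lowerRam (L : IntermediateField K Ω) (t : ℝ) : Subgroup Gal(L/K) where
  carrier := {σ | ∀ x : L, 0 ≤ extVal K (x : Ω) →
    ((t + 1 : ℝ) : WithTop ℝ) ≤ normVal L ((σ x : Ω) - (x : Ω))}
  one_mem' := by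
    intro x _
    simp [normVal]
  mul_mem' := by
    intro σ τ hσ hτ x hx
    have h := le_normVal_add (hσ (τ x) (by rwa [extVal_algEquiv])) (hτ x hx)
    simpa using h
  inv_mem' := by
    intro σ hσ x hx
    have h := hσ (σ⁻¹ x) (by rwa [extVal_algEquiv])
    have h2 : σ (σ⁻¹ x) = x := σ.apply_symm_apply x
    rw [h2] at h
    rw [normVal, AddValuation.map_sub_swap]
    exact h

/-- `b ≥ -1` is a lower ramification break of `L/K` if `G_b ≠ G_(b+ε)` for all `ε > 0`. -/
def IsLowerBreak (L : IntermediateField K Ω) (b : ℝ) : Prop :=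
  -1 ≤ b ∧ ∀ ε > 0, lowerRam L b ≠ lowerRam L (b + ε)

/-- The Hasse-Herbrand function `φ(x) = ∫_0^x dt / [G_0 : G_t]`, for `x ≥ -1`. -/
def herbrandPhi (L : IntermediateField K Ω) (x : ℝ) : ℝ :=
  ∫ t in (0 : ℝ)..x, 1 / (((lowerRam L t).relIndex (lowerRam L 0) : ℕ) : ℝ)

/-- The inverse `ψ : [-1, ∞) → [-1, ∞)` of the Hasse-Herbrand function `φ`. -/
def herbrandPsi (L : IntermediateField K Ω) : ℝ → ℝ :=
  Function.invFunOn (herbrandPhi L) (Set.Ici (-1))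

/-- The upper ramification group `G^x = G_(ψ(x))`, for `x ≥ -1`. -/
def upperRam (L : IntermediateField K Ω) (x : ℝ) : Subgroup Gal(L/K) :=
  lowerRam L (herbrandPsi L x)

/-- `u ≥ -1` is an upper ramification break of `L/K` if `G^u ≠ G^(u+ε)` for all `ε > 0`. -/
def IsUpperBreak (L : IntermediateField K Ω) (u : ℝ) : Prop :=
  -1 ≤ u ∧ ∀ ε > 0, upperRam L u ≠ upperRam L (u + ε)

end Ramification

/-! ### The tower of Artin-Schreier extensions -/

section Tower

variable {p n : ℕ} (K : Type*) [Field K] {Ω : Type*} [Field Ω] [Algebra K Ω]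

/-- `d_i = D_i(α_1, …, α_(i-1))`, where `𝔽_p` is mapped to `K` (indices shifted by one). -/
def specialize [CharP K p] (D : (i : Fin n) → MvPolynomial (Fin i) (ZMod p)) (α : Fin n → Ω)
    (i : Fin n) : Ω :=
  (D i).eval₂ ((algebraMap K Ω).comp (ZMod.castHom dvd_rfl K)) fun j => α (Fin.castLE i.isLt.le j)

/-- `K_i = K(α_1, …, α_i)`, for `0 ≤ i ≤ n` (indices of the `α` shifted by one). -/
def tower (α : Fin n → Ω) (i : ℕ) : IntermediateField K Ω :=
  IntermediateField.adjoin K {x | ∃ j : Fin n, (j : ℕ) < i ∧ α j = x}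

theorem tower_le (α : Fin n → Ω) (i : ℕ) : tower K α i ≤ tower K α n :=
  IntermediateField.adjoin.mono K _ _ fun _ ⟨j, _, h⟩ => ⟨j, j.isLt, h⟩

/-- The subgroup `Gal(K_n / K_i)` of `Gal(K_n / K)`. -/
def towerGal (α : Fin n → Ω) (i : ℕ) : Subgroup Gal(tower K α n/K) :=
  (IntermediateField.restrict (tower_le K α i)).fixingSubgroup

end Tower

end

/-! ### Additive valuations with real values -/

namespace AddValuation

section Basic

variable {F : Type*} [Field F] (v : AddValuation F (WithTop ℝ)) {x y : F} {r s : ℝ}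

/-! Let v be the extension of v_K to the separable closure, real-valued and not renormalised. A
totally ramified K_m of degree p^m then has value group p^{-m}ℤ, and the normalised valuation of K_m
is p^m v. Indices below start at 0.

The engine is the reduction of a_i modulo elements γ^p - γ of the intermediate fields. Let z
generate K_{k+1} over K_k, with A = z^p - z in K_k of normalised valuation -b and p ∤ b. Since the
residue field is perfect, every nonzero x in K_k agrees to leading order with some e^p A^j. As A =
z^p (1 - z^{1-p}), subtracting (e z^j)^p - e z^j and treating the remainder alike turns a pole of
order s > b, p ∤ s, in K_k into one of order ps - (p-1)b in K_{k+1} (`exists_reduction_eq`).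
Starting from order u_i in K, the order in K_k is b_k + p^k (u_i - u_k), by the recursion for b; at
k = i it is b_i (`exists_tower_reduction`). The bound on v(d_i) keeps d_i from disturbing the
leading term. So α_i can be replaced by z_i = α_i - γ with v(z_i) = -b_i / p^{i+1}, and p ∤ b_i
makes K_{i+1}/K_i totally ramified of degree p (`isReducedTower`).

The Galois group comes from the generic extension. The specialization Y_j ↦ α_j sends X_j to a_j ∈
K, so composing it with a K-automorphism does not change it on R_n; the two specializations differ
by a unique element of Gal(S_n/R_n) ≅ G. This gives normality and an embedding of Gal(K_n/K) in G,
bijective because the degree is at least p^n.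

For ramification, let σ first move α_i. It moves z_i by a nonzero element of 𝔽_p, so σ(z_i)/z_i - 1
has normalised valuation b_i in K_{i+1}. The same value then holds for every element of valuation
prime to p, and applying σ - 1 to the next Artin-Schreier equation shows that it persists in all
higher K_m (`IsReducedTower.displacesBy`). Hence σ has lower ramification number b_i, and
integrating the inverse indices gives φ(b_i) = u_i. -/

theorem exists_eq_coe (hx : x ≠ 0) : ∃ r : ℝ, v x = (r : WithTop ℝ) := by
  have h : v x ≠ ⊤ := (v.ne_top_iff).mpr hx
  exact ⟨(v x).untop h, (WithTop.coe_untop _ h).symm⟩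

variable {v}

theorem ne_zero_of_eq_coe (hx : v x = (r : WithTop ℝ)) : x ≠ 0 := by
  rintro rfl
  simp at hx

theorem mul_eq_coe (hx : v x = (r : WithTop ℝ)) (hy : v y = (s : WithTop ℝ)) :
    v (x * y) = ((r + s : ℝ) : WithTop ℝ) := by
  rw [v.map_mul, hx, hy, WithTop.coe_add]

theorem pow_eq_coe (hx : v x = (r : WithTop ℝ)) (k : ℕ) :
    v (x ^ k) = ((k * r : ℝ) : WithTop ℝ) := by
  induction k with
  | zero => simp
  | succ k ih =>
    rw [pow_succ, mul_eq_coe ih hx]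
    congr 1
    push_cast
    ring

theorem inv_eq_coe (hx : v x = (r : WithTop ℝ)) : v x⁻¹ = ((-r : ℝ) : WithTop ℝ) := by
  have hx0 := ne_zero_of_eq_coe hx
  obtain ⟨s, hs⟩ := v.exists_eq_coe (inv_ne_zero hx0)
  have h := mul_eq_coe hx hs
  rw [mul_inv_cancel₀ hx0, v.map_one, eq_comm] at h
  have h2 : r + s = 0 := by exact_mod_cast h
  rw [hs, eq_neg_of_add_eq_zero_right h2]

theorem div_eq_coe (hx : v x = (r : WithTop ℝ)) (hy : v y = (s : WithTop ℝ)) :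
    v (x / y) = ((r - s : ℝ) : WithTop ℝ) := by
  rw [div_eq_mul_inv, mul_eq_coe hx (inv_eq_coe hy), sub_eq_add_neg]

theorem coe_le_mul (hx : (r : WithTop ℝ) ≤ v x) (hy : (s : WithTop ℝ) ≤ v y) :
    ((r + s : ℝ) : WithTop ℝ) ≤ v (x * y) := by
  rw [v.map_mul, WithTop.coe_add]
  exact add_le_add hx hy

theorem coe_lt_mul (hx : v x = (r : WithTop ℝ)) (hy : (s : WithTop ℝ) < v y) :
    ((r + s : ℝ) : WithTop ℝ) < v (x * y) := by
  rcases eq_or_ne y 0 with rfl | hy0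
  · simp
  obtain ⟨t, ht⟩ := v.exists_eq_coe hy0
  rw [mul_eq_coe hx ht]
  rw [ht] at hy
  have := WithTop.coe_lt_coe.mp hy
  exact WithTop.coe_lt_coe.mpr (by linarith)

theorem add_eq_coe_of_lt (hx : v x = (r : WithTop ℝ)) (hy : (r : WithTop ℝ) < v y) :
    v (x + y) = (r : WithTop ℝ) := by
  rw [v.map_add_eq_of_lt_left (by rwa [hx]), hx]

theorem eq_coe_of_sub_lt (hx : v x = (r : WithTop ℝ)) (hy : (r : WithTop ℝ) < v (x - y)) :
    v y = (r : WithTop ℝ) := by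
  have h := add_eq_coe_of_lt hx (y := y - x) (by rwa [v.map_sub_swap])
  rwa [add_sub_cancel] at h

theorem natCast_nonneg (k : ℕ) : 0 ≤ v (k : F) := by
  induction k with
  | zero => simp
  | succ k ih =>
    rw [Nat.cast_succ]
    exact v.map_le_add ih (by simp)

theorem eq_zero_of_pow_eq_self {p : ℕ} (hp : 1 < p) (hx : x ≠ 0) (h : x ^ p = x) : v x = 0 := by
  obtain ⟨r, hr⟩ := v.exists_eq_coe hx
  have h1 := pow_eq_coe hr p
  rw [h, hr] at h1
  have h2 : r = p * r := by exact_mod_cast h1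
  have h3 : (1 : ℝ) < p := by exact_mod_cast hp
  have h4 : r = 0 := by
    have : (p - 1 : ℝ) * r = 0 := by linarith
    rcases mul_eq_zero.mp this with h | h
    · linarith
    · exact h
  rw [hr, h4, WithTop.coe_zero]

/-- A root of an Artin-Schreier equation with negative right hand side. -/
theorem eq_of_artinSchreier {p : ℕ} (hp : 1 < p) (hs : s < 0)
    (h : v (x ^ p - x) = (s : WithTop ℝ)) : v x = ((s / p : ℝ) : WithTop ℝ) := by
  have hp' : (1 : ℝ) < p := by exact_mod_cast hp
  have hx : x ≠ 0 := by
    rintro rfl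
    rw [zero_pow (by omega)] at h
    simp at h
  obtain ⟨r, hr⟩ := v.exists_eq_coe hx
  have h1 := pow_eq_coe hr p
  rcases lt_or_ge r 0 with hr0 | hr0
  · have h2 := add_eq_coe_of_lt h1 (y := -x) (by
      rw [v.map_neg, hr]
      exact WithTop.coe_lt_coe.mpr (by nlinarith))
    rw [← sub_eq_add_neg, h] at h2
    have h3 : s = p * r := by exact_mod_cast h2
    rw [hr, h3, mul_div_cancel_left₀ _ (by positivity)]
  · have h2 : ((0 : ℝ) : WithTop ℝ) ≤ v (x ^ p - x) := by
      refine v.map_le_sub ?_ ?_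
      · rw [h1]
        exact WithTop.coe_le_coe.mpr (by positivity)
      · rw [hr]
        exact WithTop.coe_le_coe.mpr hr0
    rw [h] at h2
    exact absurd (WithTop.coe_le_coe.mp h2) (not_le.mpr hs)

/-- The binomial expansion to first order with integral remainder, which is all that the next two
estimates need. -/
theorem exists_one_add_pow (hx : 0 ≤ v x) (k : ℕ) :
    ∃ y, (1 + x) ^ k = 1 + k * x + x ^ 2 * y ∧ 0 ≤ v y := by
  induction k with
  | zero => exact ⟨0, by simp, by simp⟩
  | succ k ih =>
    obtain ⟨y, h1, h2⟩ := ih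
    refine ⟨y + k + x * y, ?_, ?_⟩
    · rw [pow_succ, h1]
      push_cast
      ring
    · refine v.map_le_add (v.map_le_add h2 (natCast_nonneg k)) ?_
      rw [v.map_mul]
      exact add_nonneg hx h2

theorem le_one_add_pow_sub_one (hx : v x = (r : WithTop ℝ)) (hr : 0 < r) (k : ℕ) :
    (r : WithTop ℝ) ≤ v ((1 + x) ^ k - 1) := by
  have hx0 : 0 ≤ v x := by
    rw [hx]
    exact_mod_cast hr.le
  obtain ⟨y, h1, h2⟩ := exists_one_add_pow hx0 k
  have h3 : (1 + x) ^ k - 1 = x * (k + x * y) := by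
    rw [h1]
    ring
  rw [h3, v.map_mul, hx]
  refine le_add_of_nonneg_right (v.map_le_add (natCast_nonneg k) ?_)
  rw [v.map_mul]
  exact add_nonneg hx0 h2

/-- The integer k is a nonzero element of the prime field, so it has valuation 0 and the linear term
k x dominates. This is why exponents prime to p matter throughout. -/
theorem one_add_pow_sub_one_eq {p : ℕ} [Fact p.Prime] [CharP F p] (hx : v x = (r : WithTop ℝ))
    (hr : 0 < r) {k : ℕ} (hk : ¬ p ∣ k) : v ((1 + x) ^ k - 1) = (r : WithTop ℝ) := by
  have hx0 : 0 ≤ v x := by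
    rw [hx]
    exact_mod_cast hr.le
  obtain ⟨y, h1, h2⟩ := exists_one_add_pow hx0 k
  have h3 : (1 + x) ^ k - 1 = x * (k + x * y) := by
    rw [h1]
    ring
  have h4 : v (k : F) = ((0 : ℝ) : WithTop ℝ) := by
    rw [WithTop.coe_zero]
    refine eq_zero_of_pow_eq_self (Fact.out : p.Prime).one_lt
      (by rwa [Ne, CharP.cast_eq_zero_iff F p]) ?_
    exact map_natCast (frobenius F p) k
  have h5 : ((0 : ℝ) : WithTop ℝ) < v (x * y) := by
    rw [v.map_mul, hx]
    refine lt_of_lt_of_le (WithTop.coe_lt_coe.mpr hr) (le_add_of_nonneg_right h2)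
  have h6 := mul_eq_coe hx (add_eq_coe_of_lt h4 h5)
  rw [h3, h6, add_zero]

/-- The valuation of a sum whose nonzero terms have pairwise distinct valuations. -/
theorem exists_lt_sum_sub {ι : Type*} [DecidableEq ι] {t : Finset ι} {f : ι → F}
    (hf : ∀ i ∈ t, ∀ j ∈ t, i ≠ j → f i ≠ 0 → v (f i) ≠ v (f j))
    (h0 : ∃ i ∈ t, f i ≠ 0) :
    ∃ i ∈ t, f i ≠ 0 ∧ v (f i) < v (∑ j ∈ t, f j - f i) := by
  obtain ⟨i₀, hi₀, h0⟩ := h0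
  obtain ⟨i, hi, hmin⟩ := t.exists_min_image (fun j => v (f j)) ⟨i₀, hi₀⟩
  have hne : f i ≠ 0 := by
    intro h
    have := hmin i₀ hi₀
    rw [h, v.map_zero, top_le_iff, v.top_iff] at this
    exact h0 this
  refine ⟨i, hi, hne, ?_⟩
  rw [← Finset.add_sum_erase t f hi, add_sub_cancel_left]
  refine v.map_lt_sum ((v.ne_top_iff).mpr hne) fun j hj => ?_
  obtain ⟨hji, hj⟩ := Finset.mem_erase.mp hj
  exact lt_of_le_of_ne (hmin j hj) (hf i hi j hj hji.symm hne)

theorem sum_ne_zero_of_distinct {ι : Type*} [DecidableEq ι] {t : Finset ι} {f : ι → F}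
    (hf : ∀ i ∈ t, ∀ j ∈ t, i ≠ j → f i ≠ 0 → v (f i) ≠ v (f j))
    (h0 : ∃ i ∈ t, f i ≠ 0) : ∑ j ∈ t, f j ≠ 0 := by
  obtain ⟨i, -, -, h⟩ := exists_lt_sum_sub (v := v) hf h0
  intro h'
  rw [h', zero_sub, v.map_neg] at h
  exact lt_irrefl _ h

end Basic

end AddValuation

/-! ### Totally ramified subextensions of `p`-power degree -/

section Level

variable {K Ω : Type*} [Field K] [Field Ω] [Algebra K Ω]

/-- The value group of `M` is `p ^ (-m) ℤ` and its residue field is that of `K`. -/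
structure IsTotRamOfLevel (v : AddValuation Ω (WithTop ℝ)) (p m : ℕ) (M : IntermediateField K Ω) :
    Prop where
  discrete : ∀ x ∈ M, x ≠ 0 → ∃ k : ℤ, v x = ((k / p ^ m : ℝ) : WithTop ℝ)
  attained : ∀ k : ℤ, ∃ x ∈ M, v x = ((k / p ^ m : ℝ) : WithTop ℝ)
  residue : ∀ x ∈ M, v x = 0 → ∃ c : K, 0 < v (x - algebraMap K Ω c)

/-- Bézout, with the coefficient of b reduced modulo q to make it a natural number. If z has
valuation -b/q and y has valuation l, then y z^j has valuation k/q. -/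
theorem exists_nat_mul_of_coprime {b q : ℤ} (hq : 0 < q) (h : IsCoprime b q) (k : ℤ) :
    ∃ (j : ℕ) (l : ℤ), k = q * l - j * b := by
  obtain ⟨x, y, hxy⟩ := h
  have h1 : 0 ≤ (-(k * x)) % q := Int.emod_nonneg _ hq.ne'
  refine ⟨((-(k * x)) % q).toNat, k * y - (-(k * x)) / q * b, ?_⟩
  rw [Int.toNat_of_nonneg h1]
  have h2 := Int.emod_add_mul_ediv (-(k * x)) q
  have h3 : (-(k * x)) % q = -(k * x) - q * (-(k * x) / q) := by linarith
  rw [h3]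
  linear_combination (-k) * hxy

theorem isCoprime_natCast_pow {p : ℕ} (hp : p.Prime) {b : ℤ} (hb : ¬ (p : ℤ) ∣ b) (m : ℕ) :
    IsCoprime b ((p : ℤ) ^ m) :=
  (((Prime.coprime_iff_not_dvd (Nat.prime_iff_prime_int.mp hp)).mpr hb).symm).pow_right

namespace IsTotRamOfLevel

variable {v : AddValuation Ω (WithTop ℝ)} {p m : ℕ} {M M' : IntermediateField K Ω}
  {x y z A : Ω} {b : ℤ}

/-- The quotient x / y is a unit, and its residue is represented by a constant of K. -/
theorem exists_sub_algebraMap_mul (h : IsTotRamOfLevel v p m M) (hx : x ∈ M) (hy : y ∈ M)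
    {r : ℝ} (hxr : v x = (r : WithTop ℝ)) (hyr : v y = (r : WithTop ℝ)) :
    ∃ c : K, (r : WithTop ℝ) < v (x - algebraMap K Ω c * y) := by
  have h1 : v (x / y) = 0 := by
    rw [AddValuation.div_eq_coe hxr hyr, sub_self, WithTop.coe_zero]
  obtain ⟨c, hc⟩ := h.residue _ (M.div_mem hx hy) h1
  refine ⟨c, ?_⟩
  have hy0 := AddValuation.ne_zero_of_eq_coe hyr
  have h2 := AddValuation.coe_lt_mul hyr (s := 0) (by rwa [WithTop.coe_zero])
  rwa [add_zero, mul_sub, mul_div_cancel₀ _ hy0, mul_comm y] at h2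

variable [hp : Fact p.Prime]

/-- Discreteness: a strict gain in valuation is a gain of a full step 1/p^m, so successive
approximations reach any bound in finitely many steps. -/
theorem add_one_le (h : IsTotRamOfLevel v p m M) (hx : x ∈ M) (hx0 : x ≠ 0) {k : ℤ}
    (hk : ((k / p ^ m : ℝ) : WithTop ℝ) < v x) : (((k + 1) / p ^ m : ℝ) : WithTop ℝ) ≤ v x := by
  obtain ⟨l, hl⟩ := h.discrete x hx hx0
  have hp0 : (0 : ℝ) < p ^ m := pow_pos (by exact_mod_cast hp.out.pos) m
  rw [hl] at hk ⊢
  rw [WithTop.coe_lt_coe, div_lt_div_iff_of_pos_right hp0] at hk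
  have h1 : k + 1 ≤ l := by exact_mod_cast hk
  rw [WithTop.coe_le_coe, div_le_div_iff_of_pos_right hp0]
  exact_mod_cast h1

/-- Equal valuations would give p ∣ (i - j) b, impossible for distinct i, j < p. -/
theorem distinct (h : IsTotRamOfLevel v p m M)
    (hz : v z = ((-b / p ^ (m + 1) : ℝ) : WithTop ℝ)) (hb : ¬ (p : ℤ) ∣ b)
    {c : ℕ → Ω} (hc : ∀ k, c k ∈ M) :
    ∀ i ∈ Finset.range p, ∀ j ∈ Finset.range p, i ≠ j → c i * z ^ i ≠ 0 →
      v (c i * z ^ i) ≠ v (c j * z ^ j) := by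
  intro i hi j hj hij h0 heq
  have hci : c i ≠ 0 := left_ne_zero_of_mul h0
  have hcj : c j ≠ 0 := by
    intro h'
    rw [h', zero_mul, v.map_zero, v.top_iff] at heq
    exact h0 heq
  obtain ⟨k, hk⟩ := h.discrete _ (hc i) hci
  obtain ⟨l, hl⟩ := h.discrete _ (hc j) hcj
  rw [AddValuation.mul_eq_coe hk (AddValuation.pow_eq_coe hz i),
    AddValuation.mul_eq_coe hl (AddValuation.pow_eq_coe hz j), WithTop.coe_inj, pow_succ] at heq
  have hp0 : (p : ℝ) ≠ 0 := by exact_mod_cast hp.out.ne_zero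
  field_simp at heq
  have h1 : k * p - i * b = l * p - j * b := by
    have : (k * p - i * b : ℝ) = l * p - j * b := by linarith
    exact_mod_cast this
  have h2 : (p : ℤ) ∣ ((i : ℤ) - j) * b := ⟨k - l, by linarith⟩
  rcases (Nat.prime_iff_prime_int.mp hp.out).dvd_or_dvd h2 with h3 | h3
  · rw [Finset.mem_range] at hi hj
    have h4 : (i : ℤ) - j = 0 := Int.eq_zero_of_abs_lt_dvd h3 (by rw [abs_lt]; omega)
    omega
  · exact hb h3

/-- A root `z` of valuation `-b / p ^ (m + 1)` generates a totally ramified extension. -/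
theorem succ (h : IsTotRamOfLevel v p m M) (hM : M ≤ M') (hzM : z ∈ M')
    (hz : v z = ((-b / p ^ (m + 1) : ℝ) : WithTop ℝ)) (hb : ¬ (p : ℤ) ∣ b)
    (hgen : ∀ x ∈ M', ∃ c : ℕ → Ω, (∀ k, c k ∈ M) ∧ x = ∑ k ∈ Finset.range p, c k * z ^ k) :
    IsTotRamOfLevel v p (m + 1) M' := by
  have hp0 : (p : ℝ) ≠ 0 := by exact_mod_cast hp.out.ne_zero
  -- The nonzero terms of the expansion in powers of z have distinct valuations, so a single one of
  -- them dominates.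
  have key : ∀ x ∈ M', x ≠ 0 → ∃ k < p, ∃ c ∈ M, c ≠ 0 ∧
      v (c * z ^ k) < v (x - c * z ^ k) := by
    intro x hx hx0
    obtain ⟨c, hc, rfl⟩ := hgen x hx
    have : ∃ i ∈ Finset.range p, c i * z ^ i ≠ 0 := by
      by_contra! hcon
      exact hx0 (Finset.sum_eq_zero hcon)
    obtain ⟨i, hi, hi0, hlt⟩ := AddValuation.exists_lt_sum_sub (h.distinct hz hb hc) this
    exact ⟨i, Finset.mem_range.mp hi, c i, hc i, left_ne_zero_of_mul hi0, hlt⟩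
  have hval : ∀ c ∈ M, c ≠ 0 → ∀ k : ℕ, ∃ l : ℤ, v c = ((l / p ^ m : ℝ) : WithTop ℝ) ∧
      v (c * z ^ k) = (((l * p - k * b : ℤ) / p ^ (m + 1) : ℝ) : WithTop ℝ) := by
    intro c hc hc0 k
    obtain ⟨l, hl⟩ := h.discrete c hc hc0
    refine ⟨l, hl, ?_⟩
    rw [AddValuation.mul_eq_coe hl (AddValuation.pow_eq_coe hz k)]
    congr 1
    push_cast
    field_simp
    ring
  refine ⟨?_, ?_, ?_⟩
  · intro x hx hx0
    obtain ⟨k, -, c, hc, hc0, hlt⟩ := key x hx hx0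
    obtain ⟨l, -, hl⟩ := hval c hc hc0 k
    refine ⟨l * p - k * b, ?_⟩
    rw [hl] at hlt
    have := AddValuation.add_eq_coe_of_lt hl hlt
    rwa [add_sub_cancel] at this
  · intro k
    obtain ⟨j, l, hk⟩ := exists_nat_mul_of_coprime (q := p) (by exact_mod_cast hp.out.pos)
      (by simpa using isCoprime_natCast_pow hp.out hb 1) k
    obtain ⟨c, hc, hcl⟩ := h.attained l
    refine ⟨c * z ^ j, M'.mul_mem (hM hc) (pow_mem hzM j), ?_⟩
    rw [AddValuation.mul_eq_coe hcl (AddValuation.pow_eq_coe hz j), hk]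
    congr 1
    push_cast
    field_simp
    ring
  · intro x hx hx0
    have hxz : x ≠ 0 := by
      rintro rfl
      simp at hx0
    obtain ⟨k, hkp, c, hc, hc0, hlt⟩ := key x hx hxz
    obtain ⟨l, hcl, hl⟩ := hval c hc hc0 k
    have h1 : v (c * z ^ k) = 0 := by
      rw [hl] at hlt
      have := AddValuation.add_eq_coe_of_lt hl hlt
      rw [add_sub_cancel, hx0] at this
      rw [hl, ← this]
    have h2 : l * p - k * b = 0 := by
      rw [hl, ← WithTop.coe_zero, WithTop.coe_inj] at h1
      rcases div_eq_zero_iff.mp h1 with h1 | h1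
      · exact_mod_cast h1
      · exact absurd h1 (pow_ne_zero _ hp0)
    -- The dominant term of a unit is constant in z, so its residue already comes from M.
    have h3 : k = 0 := by
      have : (p : ℤ) ∣ k * b := ⟨l, by linarith⟩
      rcases (Nat.prime_iff_prime_int.mp hp.out).dvd_or_dvd this with h3 | h3
      · exact Nat.eq_zero_of_dvd_of_lt (by exact_mod_cast h3) hkp
      · exact absurd h3 hb
    subst h3
    rw [pow_zero, mul_one] at h1 hlt
    obtain ⟨d, hd⟩ := h.residue c hc h1
    refine ⟨d, ?_⟩
    rw [h1] at hlt
    have := v.map_lt_add hlt hd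
    rwa [sub_add_sub_cancel] at this

/-- Every element of `M` agrees up to higher valuation with some `c ^ p * A ^ j`. -/
theorem exists_sub_pow_mul_pow (hperf : ∀ c : K, v (algebraMap K Ω c) = 0 →
      ∃ d : K, 0 < v (algebraMap K Ω c - algebraMap K Ω d ^ p))
    (h : IsTotRamOfLevel v p m M) (hAM : A ∈ M)
    (hA : v A = ((-b / p ^ m : ℝ) : WithTop ℝ)) (hb : ¬ (p : ℤ) ∣ b) (hx : x ∈ M) {k : ℤ}
    (hxk : v x = ((k / p ^ m : ℝ) : WithTop ℝ)) :
    ∃ (j : ℕ) (c : Ω), c ∈ M ∧ (¬ (p : ℤ) ∣ k → ¬ p ∣ j) ∧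
      v (c ^ p * A ^ j) = ((k / p ^ m : ℝ) : WithTop ℝ) ∧
      ((k / p ^ m : ℝ) : WithTop ℝ) < v (x - c ^ p * A ^ j) := by
  obtain ⟨j, l, hk⟩ := exists_nat_mul_of_coprime (q := p) (by exact_mod_cast hp.out.pos)
    (by simpa using isCoprime_natCast_pow hp.out hb 1) k
  obtain ⟨e, he, hel⟩ := h.attained l
  have h1 : v (e ^ p * A ^ j) = ((k / p ^ m : ℝ) : WithTop ℝ) := by
    rw [AddValuation.mul_eq_coe (AddValuation.pow_eq_coe hel p) (AddValuation.pow_eq_coe hA j), hk]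
    congr 1
    push_cast
    field_simp
    ring
  obtain ⟨c, hc⟩ := h.exists_sub_algebraMap_mul hx
    (M.mul_mem (pow_mem he p) (pow_mem hAM j)) hxk h1
  have hc0 : v (algebraMap K Ω c) = 0 := by
    have h2 := AddValuation.eq_coe_of_sub_lt hxk hc
    have h3 := AddValuation.div_eq_coe h2 h1
    rwa [mul_div_cancel_right₀ _ (AddValuation.ne_zero_of_eq_coe h1), sub_self,
      WithTop.coe_zero] at h3
  -- The constant c is replaced by d^p with the same residue, which is absorbed into e^p.
  obtain ⟨d, hd⟩ := hperf c hc0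
  have h2 : ((k / p ^ m : ℝ) : WithTop ℝ) < v (x - (algebraMap K Ω d * e) ^ p * A ^ j) := by
    have h3 := AddValuation.coe_lt_mul h1 (s := 0) (by rwa [WithTop.coe_zero])
    rw [add_zero] at h3
    have h4 := v.map_lt_add hc h3
    convert h4 using 2
    ring
  refine ⟨j, algebraMap K Ω d * e, M.mul_mem (M.algebraMap_mem d) he, ?_,
    AddValuation.eq_coe_of_sub_lt hxk h2, h2⟩
  intro hpk hpj
  refine hpk ?_
  rw [hk]
  exact dvd_sub (dvd_mul_right _ _) (dvd_mul_of_dvd_left (by exact_mod_cast hpj) _)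

/-! ### Reduction modulo Artin-Schreier elements -/

section Reduction

variable [CharP Ω p]

/-- The difference between `c ^ p A ^ j` and `(c z ^ j) ^ p`, where `A = z ^ p - z`. -/
theorem sub_pow_estimate (hb0 : 0 < b)
    (hz : v z = ((-b / p ^ (m + 1) : ℝ) : WithTop ℝ)) {r : ℝ} {j : ℕ}
    (hx : v (x ^ p * (z ^ p - z) ^ j) = (r : WithTop ℝ))
    (hA : v (z ^ p - z) = ((-b / p ^ m : ℝ) : WithTop ℝ)) :
    ((r + (p - 1) * b / p ^ (m + 1) : ℝ) : WithTop ℝ) ≤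
        v (x ^ p * (z ^ p - z) ^ j - (x * z ^ j) ^ p) ∧
      (¬ p ∣ j → v (x ^ p * (z ^ p - z) ^ j - (x * z ^ j) ^ p) =
        ((r + (p - 1) * b / p ^ (m + 1) : ℝ) : WithTop ℝ)) ∧
      v (x * z ^ j) = ((r / p : ℝ) : WithTop ℝ) := by
  have hp1 : (1 : ℝ) < p := by exact_mod_cast hp.out.one_lt
  have hp0 : (0 : ℝ) < p := by linarith
  have hpm : (0 : ℝ) < p ^ (m + 1) := pow_pos hp0 _
  have hb' : (0 : ℝ) < b := by exact_mod_cast hb0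
  have hz0 : z ≠ 0 := AddValuation.ne_zero_of_eq_coe hz
  set ε : Ω := -(z ^ (p - 1))⁻¹ with hε
  have hεv : v ε = (((p - 1) * b / p ^ (m + 1) : ℝ) : WithTop ℝ) := by
    rw [hε, v.map_neg, AddValuation.inv_eq_coe (AddValuation.pow_eq_coe hz (p - 1)),
      Nat.cast_sub hp.out.one_lt.le]
    congr 1
    push_cast
    ring
  have hε0 : (0 : ℝ) < (p - 1) * b / p ^ (m + 1) :=
    div_pos (mul_pos (by linarith) hb') hpm
  have hAz : z ^ p - z = z ^ p * (1 + ε) := by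
    have h1 : z ^ p = z ^ (p - 1) * z := by
      rw [← pow_succ, Nat.sub_add_cancel hp.out.one_lt.le]
    rw [hε, mul_add, mul_one, sub_eq_add_neg, mul_neg, h1]
    congr 2
    rw [mul_comm, ← mul_assoc, inv_mul_cancel₀ (pow_ne_zero _ hz0), one_mul]
  have h1 : x ^ p * (z ^ p - z) ^ j - (x * z ^ j) ^ p =
      (x * z ^ j) ^ p * ((1 + ε) ^ j - 1) := by
    rw [hAz, mul_pow, mul_pow]
    ring
  have hx0 : x ^ p ≠ 0 := left_ne_zero_of_mul (AddValuation.ne_zero_of_eq_coe hx)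
  have hx0' : x ≠ 0 := by
    rintro rfl
    exact hx0 (zero_pow hp.out.ne_zero)
  obtain ⟨s, hs⟩ := v.exists_eq_coe (mul_ne_zero hx0' (pow_ne_zero j hz0))
  have hsr : p * s = r := by
    have h2 : v ((x * z ^ j) ^ p) = ((p * s : ℝ) : WithTop ℝ) := AddValuation.pow_eq_coe hs p
    obtain ⟨t, ht⟩ := v.exists_eq_coe hx0'
    have h3 := AddValuation.mul_eq_coe (AddValuation.pow_eq_coe ht p) (AddValuation.pow_eq_coe hA j)
    have h4 := AddValuation.mul_eq_coe ht (AddValuation.pow_eq_coe hz j)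
    rw [hs, WithTop.coe_inj] at h4
    rw [hx, WithTop.coe_inj] at h3
    rw [h3, h4]
    field_simp
    ring
  have hpow : v ((x * z ^ j) ^ p) = (r : WithTop ℝ) := by
    rw [← hsr]
    exact AddValuation.pow_eq_coe hs p
  refine ⟨?_, ?_, ?_⟩
  · rw [h1]
    exact AddValuation.coe_le_mul hpow.ge (AddValuation.le_one_add_pow_sub_one hεv hε0 j)
  · intro hj
    rw [h1]
    exact AddValuation.mul_eq_coe hpow (AddValuation.one_add_pow_sub_one_eq (p := p) hεv hε0 hj)
  · rw [hs, ← hsr, mul_div_cancel_left₀ _ hp0.ne']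

/-- The leading term e^p A^j of x is traded for (e z^j)^p. The cost is the error in
`sub_pow_estimate` together with e z^j, and both stay within the bound because b ≤ c. What remains
of x has larger valuation and is treated in the same way. -/
theorem exists_reduction_le (hperf : ∀ c : K, v (algebraMap K Ω c) = 0 →
      ∃ d : K, 0 < v (algebraMap K Ω c - algebraMap K Ω d ^ p))
    (h : IsTotRamOfLevel v p m M) (hM : M ≤ M') (hzM : z ∈ M') (hAM : z ^ p - z ∈ M)
    (hA : v (z ^ p - z) = ((-b / p ^ m : ℝ) : WithTop ℝ))
    (hz : v z = ((-b / p ^ (m + 1) : ℝ) : WithTop ℝ))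
    (hb0 : 0 < b) (hb : ¬ (p : ℤ) ∣ b) {c : ℤ} (hbc : b ≤ c) (hx : x ∈ M)
    (hxc : ((-c / p ^ m : ℝ) : WithTop ℝ) ≤ v x) :
    ∃ γ ∈ M', ((-(p * c - (p - 1) * b) / p ^ (m + 1) : ℝ) : WithTop ℝ) ≤
      v (x - (γ ^ p - γ)) := by
  have hp1 : (1 : ℝ) < p := by exact_mod_cast hp.out.one_lt
  have hp0 : (0 : ℝ) < p := by linarith
  have hpm : (0 : ℝ) < p ^ m := pow_pos hp0 _
  have hpm' : (0 : ℝ) < p ^ (m + 1) := pow_pos hp0 _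
  have hb' : (0 : ℝ) < b := by exact_mod_cast hb0
  have hbc' : (b : ℝ) ≤ c := by exact_mod_cast hbc
  -- N bounds the pole order of x, in steps of 1/p^m, and decreases; c, and with it the target
  -- bound, stays fixed. At N = 0 the choice γ = 0 is enough.
  have key : ∀ N : ℕ, ∀ x ∈ M, ((-c / p ^ m : ℝ) : WithTop ℝ) ≤ v x →
      ((-N / p ^ m : ℝ) : WithTop ℝ) ≤ v x →
      ∃ γ ∈ M', ((-(p * c - (p - 1) * b) / p ^ (m + 1) : ℝ) : WithTop ℝ) ≤
        v (x - (γ ^ p - γ)) := by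
    intro N
    induction N with
    | zero =>
      intro x _ _ hx0
      refine ⟨0, M'.zero_mem, ?_⟩
      rw [zero_pow hp.out.ne_zero, sub_zero, sub_zero]
      refine le_trans ?_ hx0
      rw [WithTop.coe_le_coe, div_le_div_iff₀ hpm' hpm]
      have : 0 ≤ (p * c - (p - 1) * b : ℝ) := by nlinarith
      push_cast
      nlinarith
    | succ N ih =>
      intro x hx hxc hxN
      by_cases hlt : ((-N / p ^ m : ℝ) : WithTop ℝ) ≤ v x
      · exact ih x hx hxc hlt
      have hx0 : x ≠ 0 := by
        rintro rfl
        simp at hlt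
      obtain ⟨k, hk⟩ := h.discrete x hx hx0
      obtain ⟨j, e, he, -, hval, hlt'⟩ :=
        h.exists_sub_pow_mul_pow hperf hAM hA hb hx hk
      obtain ⟨h1, -, h2⟩ := sub_pow_estimate hb0 hz hval hA
      have hkc : -(c : ℝ) ≤ k := by
        rw [hk, WithTop.coe_le_coe, div_le_div_iff_of_pos_right hpm] at hxc
        exact hxc
      have hkN : -(N + 1 : ℝ) ≤ k := by
        rw [hk, WithTop.coe_le_coe, div_le_div_iff_of_pos_right hpm] at hxN
        exact_mod_cast hxN
      have hr : ∃ γ ∈ M', ((-(p * c - (p - 1) * b) / p ^ (m + 1) : ℝ) : WithTop ℝ) ≤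
          v (x - e ^ p * (z ^ p - z) ^ j - (γ ^ p - γ)) := by
        have hmem : x - e ^ p * (z ^ p - z) ^ j ∈ M :=
          M.sub_mem hx (M.mul_mem (pow_mem he p) (pow_mem hAM j))
        rcases eq_or_ne (x - e ^ p * (z ^ p - z) ^ j) 0 with h0 | h0
        · refine ⟨0, M'.zero_mem, ?_⟩
          rw [h0, zero_pow hp.out.ne_zero]
          simp
        · have h3 := h.add_one_le hmem h0 hlt'
          refine ih _ hmem (le_trans ?_ h3) (le_trans ?_ h3)
          · rw [WithTop.coe_le_coe, div_le_div_iff_of_pos_right hpm]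
            linarith
          · rw [WithTop.coe_le_coe, div_le_div_iff_of_pos_right hpm]
            linarith
      obtain ⟨γ, hγ, hγr⟩ := hr
      refine ⟨e * z ^ j + γ, M'.add_mem (M'.mul_mem (hM he) (pow_mem hzM j)) hγ, ?_⟩
      have h4 : x - ((e * z ^ j + γ) ^ p - (e * z ^ j + γ)) =
          (e ^ p * (z ^ p - z) ^ j - (e * z ^ j) ^ p) + e * z ^ j +
            (x - e ^ p * (z ^ p - z) ^ j - (γ ^ p - γ)) := by
        rw [add_pow_char]
        ring
      rw [h4]
      refine v.map_le_add (v.map_le_add (le_trans ?_ h1) ?_) hγr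
      · rw [WithTop.coe_le_coe, pow_succ]
        have h5 : (p * k + (p - 1) * b) / (p ^ m * p) =
            (k / p ^ m + (p - 1) * b / (p ^ m * p) : ℝ) := by
          field_simp
        rw [← h5, div_le_div_iff_of_pos_right (by positivity)]
        nlinarith
      · rw [h2, WithTop.coe_le_coe, pow_succ, div_div,
          div_le_div_iff_of_pos_right (by positivity)]
        nlinarith
  obtain ⟨N, hN⟩ := exists_nat_ge (c : ℝ)
  refine key N x hx hxc (le_trans ?_ hxc)
  rw [WithTop.coe_le_coe, div_le_div_iff_of_pos_right hpm]
  linarith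

/-- Since p ∤ c, the exponent j of the leading term is prime to p and its error has exactly the
target valuation. The element e z^j lies strictly higher because b < c, and the rest of x, having
pole order at most c - 1, is handled by `exists_reduction_le` with c - 1 in place of c. -/
theorem exists_reduction_eq (hperf : ∀ c : K, v (algebraMap K Ω c) = 0 →
      ∃ d : K, 0 < v (algebraMap K Ω c - algebraMap K Ω d ^ p))
    (h : IsTotRamOfLevel v p m M) (hM : M ≤ M') (hzM : z ∈ M') (hAM : z ^ p - z ∈ M)
    (hA : v (z ^ p - z) = ((-b / p ^ m : ℝ) : WithTop ℝ))
    (hz : v z = ((-b / p ^ (m + 1) : ℝ) : WithTop ℝ))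
    (hb0 : 0 < b) (hb : ¬ (p : ℤ) ∣ b) {c : ℤ} (hbc : b < c) (hpc : ¬ (p : ℤ) ∣ c) (hx : x ∈ M)
    (hxc : v x = ((-c / p ^ m : ℝ) : WithTop ℝ)) :
    ∃ γ ∈ M', v (x - (γ ^ p - γ)) =
      ((-(p * c - (p - 1) * b) / p ^ (m + 1) : ℝ) : WithTop ℝ) := by
  have hp1 : (1 : ℝ) < p := by exact_mod_cast hp.out.one_lt
  have hp0 : (0 : ℝ) < p := by linarith
  have hpm : (0 : ℝ) < p ^ m := pow_pos hp0 _
  have hpm' : (0 : ℝ) < p ^ (m + 1) := pow_pos hp0 _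
  have hbc' : (b : ℝ) < c := by exact_mod_cast hbc
  have hxc' : v x = (((-c : ℤ) / p ^ m : ℝ) : WithTop ℝ) := by
    rw [hxc]
    push_cast
    rfl
  obtain ⟨j, e, he, hj, hval, hlt'⟩ := h.exists_sub_pow_mul_pow hperf hAM hA hb hx hxc'
  obtain ⟨-, h1, h2⟩ := sub_pow_estimate hb0 hz hval hA
  replace h1 := h1 (hj (by rwa [dvd_neg]))
  have hr : ∃ γ ∈ M', ((-(p * (c - 1 : ℤ) - (p - 1) * b) / p ^ (m + 1) : ℝ) : WithTop ℝ) ≤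
      v (x - e ^ p * (z ^ p - z) ^ j - (γ ^ p - γ)) := by
    have hmem : x - e ^ p * (z ^ p - z) ^ j ∈ M :=
      M.sub_mem hx (M.mul_mem (pow_mem he p) (pow_mem hAM j))
    rcases eq_or_ne (x - e ^ p * (z ^ p - z) ^ j) 0 with h0 | h0
    · refine ⟨0, M'.zero_mem, ?_⟩
      rw [h0, zero_pow hp.out.ne_zero]
      simp
    · have h3 := h.add_one_le hmem h0 hlt'
      refine h.exists_reduction_le hperf hM hzM hAM hA hz hb0 hb (by omega) hmem (le_trans ?_ h3)
      rw [WithTop.coe_le_coe, div_le_div_iff_of_pos_right hpm]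
      push_cast
      linarith
  obtain ⟨γ, hγ, hγr⟩ := hr
  refine ⟨e * z ^ j + γ, M'.add_mem (M'.mul_mem (hM he) (pow_mem hzM j)) hγ, ?_⟩
  have h4 : x - ((e * z ^ j + γ) ^ p - (e * z ^ j + γ)) =
      (e ^ p * (z ^ p - z) ^ j - (e * z ^ j) ^ p) + (e * z ^ j +
        (x - e ^ p * (z ^ p - z) ^ j - (γ ^ p - γ))) := by
    rw [add_pow_char]
    ring
  have h5 : ((-c : ℤ) / p ^ m + (p - 1) * b / p ^ (m + 1) : ℝ) =
      -(p * c - (p - 1) * b) / p ^ (m + 1) := by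
    push_cast
    field_simp
    ring
  rw [h5] at h1
  rw [h4]
  refine AddValuation.add_eq_coe_of_lt h1 (v.map_lt_add ?_ (lt_of_lt_of_le ?_ hγr))
  · rw [h2, WithTop.coe_lt_coe, pow_succ, div_div, div_lt_div_iff_of_pos_right (by positivity)]
    push_cast
    nlinarith
  · rw [WithTop.coe_lt_coe, div_lt_div_iff_of_pos_right hpm']
    push_cast
    linarith

end Reduction

end IsTotRamOfLevel

end Level

/-! ### Displacement of elements by automorphisms -/

section Displacement

variable {K Ω : Type*} [Field K] [Field Ω] [Algebra K Ω]

/-- The valuation of `σ x / x - 1`, for `x ∈ M`, is at least `e`, with equality when the valuation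
of `x` in `p ^ (-m) ℤ` is prime to `p`. -/
structure DisplacesBy (v : AddValuation Ω (WithTop ℝ)) (p m : ℕ) (M : IntermediateField K Ω)
    (σ : Ω →ₐ[K] Ω) (e : ℝ) : Prop where
  le : ∀ x ∈ M, ∀ r : ℝ, v x = (r : WithTop ℝ) → ((r + e : ℝ) : WithTop ℝ) ≤ v (σ x - x)
  eq : ∀ x ∈ M, ∀ k : ℤ, ¬ (p : ℤ) ∣ k → v x = ((k / p ^ m : ℝ) : WithTop ℝ) →
    v (σ x - x) = ((k / p ^ m + e : ℝ) : WithTop ℝ)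

variable {v : AddValuation Ω (WithTop ℝ)} {p m : ℕ} {M M' : IntermediateField K Ω}
  {z : Ω} {b : ℤ} {σ : Ω →ₐ[K] Ω} {e : ℝ} [hp : Fact p.Prime]

/-- The leading term can be a monomial in z with coefficient in K itself, which σ fixes. For this
Bézout is applied modulo p^(m+1), and p ∤ k still forces p ∤ j. -/
theorem IsTotRamOfLevel.exists_sub_mul_pow (h : IsTotRamOfLevel v p (m + 1) M)
    (hK : ∀ l : ℤ, ∃ y : K, v (algebraMap K Ω y) = ((l : ℝ) : WithTop ℝ)) (hzM : z ∈ M)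
    (hz : v z = ((-b / p ^ (m + 1) : ℝ) : WithTop ℝ)) (hb : ¬ (p : ℤ) ∣ b) {x : Ω} (hx : x ∈ M)
    {k : ℤ} (hk : v x = ((k / p ^ (m + 1) : ℝ) : WithTop ℝ)) :
    ∃ (j : ℕ) (y : K), (¬ (p : ℤ) ∣ k → ¬ p ∣ j) ∧
      v (algebraMap K Ω y * z ^ j) = ((k / p ^ (m + 1) : ℝ) : WithTop ℝ) ∧
      ((k / p ^ (m + 1) : ℝ) : WithTop ℝ) < v (x - algebraMap K Ω y * z ^ j) := by
  have hp0 : (p : ℝ) ≠ 0 := by exact_mod_cast hp.out.ne_zero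
  obtain ⟨j, l, hkl⟩ := exists_nat_mul_of_coprime (q := (p : ℤ) ^ (m + 1))
    (pow_pos (by exact_mod_cast hp.out.pos) _) (isCoprime_natCast_pow hp.out hb (m + 1)) k
  obtain ⟨y, hy⟩ := hK l
  have h1 : v (algebraMap K Ω y * z ^ j) = ((k / p ^ (m + 1) : ℝ) : WithTop ℝ) := by
    rw [AddValuation.mul_eq_coe hy (AddValuation.pow_eq_coe hz j), hkl]
    congr 1
    push_cast
    field_simp
    ring
  obtain ⟨c, hc⟩ := h.exists_sub_algebraMap_mul hx
    (M.mul_mem (M.algebraMap_mem y) (pow_mem hzM j)) hk h1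
  rw [← mul_assoc, ← map_mul] at hc
  refine ⟨j, c * y, ?_, AddValuation.eq_coe_of_sub_lt hk hc, hc⟩
  intro hpk hpj
  refine hpk ?_
  rw [hkl]
  exact dvd_sub (dvd_mul_of_dvd_left (dvd_pow_self _ (Nat.succ_ne_zero m)) _)
    (dvd_mul_of_dvd_left (by exact_mod_cast hpj) _)

/-- The displacement of an element of valuation prime to `p` determines that of all others. -/
theorem DisplacesBy.of_generator [CharP Ω p] (h : IsTotRamOfLevel v p (m + 1) M)
    (hK : ∀ l : ℤ, ∃ y : K, v (algebraMap K Ω y) = ((l : ℝ) : WithTop ℝ)) (hzM : z ∈ M)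
    (hz : v z = ((-b / p ^ (m + 1) : ℝ) : WithTop ℝ)) (hb : ¬ (p : ℤ) ∣ b)
    (hσ : ∀ x, v (σ x) = v x) (he : 0 < e)
    (hσz : v (σ z - z) = ((-b / p ^ (m + 1) + e : ℝ) : WithTop ℝ)) :
    DisplacesBy v p (m + 1) M σ e := by
  have hp1 : (0 : ℝ) < p := by exact_mod_cast hp.out.pos
  have hpm : (0 : ℝ) < p ^ (m + 1) := pow_pos hp1 _
  have hz0 : z ≠ 0 := AddValuation.ne_zero_of_eq_coe hz
  set ε : Ω := (σ z - z) / z with hε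
  have hεv : v ε = (e : WithTop ℝ) := by
    rw [hε, AddValuation.div_eq_coe hσz hz]
    congr 1
    ring
  have hσε : σ z = z * (1 + ε) := by
    rw [hε, mul_add, mul_one, mul_div_cancel₀ _ hz0, add_sub_cancel]
  have hmon : ∀ (y : K) (j : ℕ), σ (algebraMap K Ω y * z ^ j) - algebraMap K Ω y * z ^ j =
      algebraMap K Ω y * z ^ j * ((1 + ε) ^ j - 1) := by
    intro y j
    rw [map_mul, map_pow, AlgHom.commutes, hσε, mul_pow]
    ring
  have hsplit : ∀ x w : Ω, σ x - x = (σ w - w) + (σ (x - w) - (x - w)) := by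
    intro x w
    rw [map_sub]
    ring
  -- The bound is first proved truncated at T, by induction on the number of steps from v x up to T.
  -- Beyond T it is trivial because σ preserves v. Taking T = r + e below removes the truncation.
  have key : ∀ T : ℝ, ∀ N : ℕ, ∀ x ∈ M, ∀ r : ℝ, v x = (r : WithTop ℝ) →
      T - N / p ^ (m + 1) ≤ r → ((min T (r + e) : ℝ) : WithTop ℝ) ≤ v (σ x - x) := by
    intro T N
    induction N with
    | zero =>
      intro x _ r hr hT
      have h1 : ((min T (r + e) : ℝ) : WithTop ℝ) ≤ v x := by
        rw [hr, WithTop.coe_le_coe]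
        simp only [Nat.cast_zero, zero_div, sub_zero] at hT
        exact (min_le_left _ _).trans hT
      exact v.map_le_sub (by rwa [hσ]) h1
    | succ N ih =>
      intro x hx r hr hT
      obtain ⟨k, hk⟩ := h.discrete x hx (AddValuation.ne_zero_of_eq_coe hr)
      have hrk : r = k / p ^ (m + 1) := by
        rw [hr] at hk
        exact_mod_cast hk
      obtain ⟨j, y, -, hval, hlt⟩ := h.exists_sub_mul_pow hK hzM hz hb hx hk
      rw [hsplit x (algebraMap K Ω y * z ^ j), hmon]
      refine v.map_le_add (le_trans ?_ (AddValuation.coe_le_mul hval.ge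
        (AddValuation.le_one_add_pow_sub_one hεv he j))) ?_
      · rw [← hrk]
        exact WithTop.coe_le_coe.mpr (min_le_right _ _)
      · have hmem : x - algebraMap K Ω y * z ^ j ∈ M :=
          M.sub_mem hx (M.mul_mem (M.algebraMap_mem y) (pow_mem hzM j))
        rcases eq_or_ne (x - algebraMap K Ω y * z ^ j) 0 with h0 | h0
        · rw [h0]
          simp
        obtain ⟨s, hs⟩ := v.exists_eq_coe h0
        have h1 := h.add_one_le hmem h0 hlt
        rw [hs, WithTop.coe_le_coe, add_div, ← hrk] at h1
        have h2 : 0 < 1 / (p : ℝ) ^ (m + 1) := by positivity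
        refine le_trans ?_ (ih _ hmem s hs ?_)
        · exact WithTop.coe_le_coe.mpr (min_le_min le_rfl (by linarith))
        · rw [Nat.cast_succ, add_div] at hT
          linarith
  have hle : ∀ x ∈ M, ∀ r : ℝ, v x = (r : WithTop ℝ) →
      ((r + e : ℝ) : WithTop ℝ) ≤ v (σ x - x) := by
    intro x hx r hr
    obtain ⟨N, hN⟩ := exists_nat_ge (e * p ^ (m + 1))
    have h1 := key (r + e) N x hx r hr (by
      rw [← le_div_iff₀ hpm] at hN
      linarith)
    rwa [min_self] at h1
  refine ⟨hle, ?_⟩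
  intro x hx k hpk hk
  obtain ⟨j, y, hj, hval, hlt⟩ := h.exists_sub_mul_pow hK hzM hz hb hx hk
  have h1 := AddValuation.mul_eq_coe hval (AddValuation.one_add_pow_sub_one_eq hεv he (hj hpk))
  rw [hsplit x (algebraMap K Ω y * z ^ j), hmon]
  refine AddValuation.add_eq_coe_of_lt h1 ?_
  have hmem : x - algebraMap K Ω y * z ^ j ∈ M :=
    M.sub_mem hx (M.mul_mem (M.algebraMap_mem y) (pow_mem hzM j))
  rcases eq_or_ne (x - algebraMap K Ω y * z ^ j) 0 with h0 | h0
  · rw [h0]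
    simp
  obtain ⟨s, hs⟩ := v.exists_eq_coe h0
  rw [hs, WithTop.coe_lt_coe] at hlt
  exact lt_of_lt_of_le (WithTop.coe_lt_coe.mpr (by linarith)) (hle _ hmem s hs)

/-- Displacement by an automorphism fixing the base of an Artin-Schreier extension. -/
theorem DisplacesBy.of_fixed [CharP Ω p] (h : IsTotRamOfLevel v p (m + 1) M)
    (hK : ∀ l : ℤ, ∃ y : K, v (algebraMap K Ω y) = ((l : ℝ) : WithTop ℝ)) (hzM : z ∈ M)
    (hz : v z = ((-b / p ^ (m + 1) : ℝ) : WithTop ℝ)) (hb : ¬ (p : ℤ) ∣ b) (hb0 : 0 < b)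
    (hσ : ∀ x, v (σ x) = v x) (hA : σ (z ^ p - z) = z ^ p - z) (hσz : σ z ≠ z) :
    DisplacesBy v p (m + 1) M σ (b / p ^ (m + 1)) := by
  have hp1 : (0 : ℝ) < p := by exact_mod_cast hp.out.pos
  have hb' : (0 : ℝ) < b := by exact_mod_cast hb0
  refine of_generator h hK hzM hz hb hσ (by positivity) ?_
  -- Two roots of the same Artin-Schreier equation differ by a solution of t^p = t, here nonzero,
  -- hence of valuation 0.
  have h1 : (σ z - z) ^ p = σ z - z := by
    rw [map_sub, map_pow] at hA
    rw [sub_pow_char]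
    linear_combination hA
  rw [AddValuation.eq_zero_of_pow_eq_self hp.out.one_lt (sub_ne_zero.mpr hσz) h1, neg_div,
    neg_add_cancel, WithTop.coe_zero]

/-- Displacement passes to an Artin-Schreier extension of larger ramification break. -/
theorem DisplacesBy.succ [CharP Ω p] (h : IsTotRamOfLevel v p (m + 1) M')
    (hK : ∀ l : ℤ, ∃ y : K, v (algebraMap K Ω y) = ((l : ℝ) : WithTop ℝ)) (hzM : z ∈ M')
    (hz : v z = ((-b / p ^ (m + 1) : ℝ) : WithTop ℝ)) (hb : ¬ (p : ℤ) ∣ b)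
    (hσ : ∀ x, v (σ x) = v x) (hAM : z ^ p - z ∈ M)
    (hA : v (z ^ p - z) = ((-b / p ^ m : ℝ) : WithTop ℝ)) {c : ℤ} (hc0 : 0 < c) (hcb : c < b)
    (hM : DisplacesBy v p m M σ (c / p ^ m)) :
    DisplacesBy v p (m + 1) M' σ (c / p ^ (m + 1)) := by
  have hp1 : (0 : ℝ) < p := by exact_mod_cast hp.out.pos
  have hc' : (0 : ℝ) < c := by exact_mod_cast hc0
  have hcb' : (c : ℝ) < b := by exact_mod_cast hcb
  refine of_generator h hK hzM hz hb hσ (by positivity) ?_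
  have h1 := hM.eq _ hAM (-b) (by rwa [dvd_neg]) (by
    rw [hA]
    push_cast
    rfl)
  -- So σ z - z solves an Artin-Schreier equation whose right-hand side has valuation (c - b)/p^m.
  -- This is negative because c < b, and the root has valuation (c - b)/p^(m+1).
  have h2 : σ (z ^ p - z) - (z ^ p - z) = (σ z - z) ^ p - (σ z - z) := by
    rw [sub_pow_char, map_sub, map_pow]
    ring
  rw [h2] at h1
  rw [AddValuation.eq_of_artinSchreier hp.out.one_lt ?_ h1]
  · congr 1
    push_cast
    field_simp
    ring
  · push_cast
    rw [← add_div]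
    exact div_neg_of_neg_of_pos (by linarith) (by positivity)

end Displacement

/-! ### Specializations of generic extensions -/

section Specialization

variable {p n : ℕ} [Fact p.Prime] {G : Type*} [Group G] {F : PFilteredGroup p n G}
  {D : (i : Fin n) → MvPolynomial (Fin i) (ZMod p)} {E : Type*} [Field E] [Algebra (ZMod p) E]

/-- The specialization `S_i → E`, `Y_j ↦ α_j`. -/
noncomputable def specHom (α : Fin n → E) (i : Fin (n + 1)) :
    MvPolynomial (Fin i) (ZMod p) →ₐ[ZMod p] E :=
  MvPolynomial.aeval fun j => α (Fin.castLE (Nat.le_of_lt_succ i.isLt) j)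

theorem specHom_genericIncl (α : Fin n → E) (i : Fin n) (s) :
    specHom α i.succ (genericIncl (p := p) i s) = specHom α i.castSucc s := by
  rw [specHom, genericIncl, MvPolynomial.aeval_rename]
  rfl

theorem genericIncl_genericX (i : Fin n) (j : Fin i.castSucc) :
    genericIncl i (genericX D i.castSucc j) = genericX D i.succ (Fin.castLE (Nat.le_succ i) j) := by
  simp only [genericIncl, genericX, map_sub, map_pow, MvPolynomial.rename_X,
    MvPolynomial.rename_rename]
  rfl

theorem genericX_last (i : Fin n) :
    genericX D i.succ (Fin.last (i : ℕ)) =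
      MvPolynomial.X (Fin.last (i : ℕ)) ^ p - MvPolynomial.X (Fin.last (i : ℕ)) -
        genericIncl i (D i) := rfl

theorem genericGal_genericX {i : Fin (n + 1)} (σ : GenericGal D i) (j : Fin i) :
    σ (genericX D i j) = genericX D i j :=
  σ.commutes ⟨genericX D i j, Algebra.subset_adjoin ⟨j, rfl⟩⟩

/-- The substitution `Y_(i+1) ↦ Y_(i+1) + c` of `S_(i+1)`. -/
noncomputable def translateHom (i : Fin n) (c : ZMod p) :
    MvPolynomial (Fin i.succ) (ZMod p) →ₐ[ZMod p] MvPolynomial (Fin i.succ) (ZMod p) :=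
  MvPolynomial.aeval fun j =>
    if (j : ℕ) = i then MvPolynomial.X j + MvPolynomial.C c else MvPolynomial.X j

theorem translateHom_rename (i : Fin n) (c : ZMod p) {k : ℕ} (hk : k ≤ i) (h : k ≤ i.succ) (s) :
    translateHom i c (MvPolynomial.rename (Fin.castLE h) s) =
      MvPolynomial.rename (Fin.castLE h) s := by
  have hcomp : (translateHom i c).comp (MvPolynomial.rename (Fin.castLE h)) =
      MvPolynomial.rename (Fin.castLE h) := by
    refine MvPolynomial.algHom_ext fun j => ?_
    have : (j : ℕ) ≠ i := by omega
    simp [translateHom, this]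
  exact DFunLike.congr_fun hcomp s

theorem translateHom_last (i : Fin n) (c : ZMod p) :
    translateHom i c (MvPolynomial.X (Fin.last (i : ℕ))) =
      MvPolynomial.X (Fin.last (i : ℕ)) + MvPolynomial.C c := by
  rw [translateHom, MvPolynomial.aeval_X, if_pos (by simp)]

/-- Only the last variable moves, and Y^p - Y is invariant under Y ↦ Y + c because c^p = c in 𝔽_p.
-/
theorem translateHom_genericX (i : Fin n) (c : ZMod p) (j : Fin i.succ) :
    translateHom i c (genericX D i.succ j) = genericX D i.succ j := by
  rw [genericX, map_sub, translateHom_rename i c (Nat.le_of_lt_succ j.isLt), map_sub, map_pow]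
  congr 1
  rw [translateHom, MvPolynomial.aeval_X]
  split_ifs with h
  · rw [add_pow_char, ← map_pow, ZMod.pow_card]
    ring
  · rfl

theorem translateHom_add (i : Fin n) (c d : ZMod p) :
    (translateHom i c).comp (translateHom i d) = translateHom i (c + d) := by
  ext j
  congr 1
  simp only [translateHom, AlgHom.comp_apply, MvPolynomial.aeval_X]
  split_ifs with h
  · simp [h, MvPolynomial.algHom_C, add_assoc]
  · simp [h]

theorem translateHom_zero (i : Fin n) :
    translateHom i (0 : ZMod p) = AlgHom.id _ _ := by
  ext j
  simp [translateHom]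

theorem translateHom_genericBase (i : Fin n) (c : ZMod p) {s} (hs : s ∈ genericBase D i.succ) :
    translateHom i c s = s := by
  have : genericBase D i.succ ≤ AlgHom.equalizer (translateHom i c) (AlgHom.id _ _) := by
    refine Algebra.adjoin_le ?_
    rintro _ ⟨j, rfl⟩
    exact translateHom_genericX i c j
  exact this hs

/-- The `R_(i+1)`-automorphism `Y_(i+1) ↦ Y_(i+1) + c` of `S_(i+1)`. -/
noncomputable def translateAut (D : (i : Fin n) → MvPolynomial (Fin i) (ZMod p)) (i : Fin n)
    (c : ZMod p) : GenericGal D i.succ :=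
  AlgEquiv.ofAlgHom
    { (translateHom i c).toRingHom with
      commutes' := fun r => translateHom_genericBase i c r.2 }
    { (translateHom i (-c)).toRingHom with
      commutes' := fun r => translateHom_genericBase i (-c) r.2 }
    (AlgHom.ext fun s => by
      have h := DFunLike.congr_fun (translateHom_add i c (-c)) s
      rw [add_neg_cancel, translateHom_zero] at h
      exact h)
    (AlgHom.ext fun s => by
      have h := DFunLike.congr_fun (translateHom_add i (-c) c) s
      rw [neg_add_cancel, translateHom_zero] at h
      exact h)

theorem translateAut_apply (i : Fin n) (c : ZMod p) (s) :
    translateAut D i c s = translateHom i c s := rfl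

theorem exists_zmod_of_pow_eq_self {x : E} (hx : x ^ p = x) :
    ∃ c : ZMod p, algebraMap (ZMod p) E c = x := by
  have : CharP E p := charP_of_injective_algebraMap (algebraMap (ZMod p) E).injective p
  have h := (Subfield.mem_bot_iff_pow_eq_self E p).mpr hx
  have hle : (⊥ : Subfield E) ≤ (algebraMap (ZMod p) E).fieldRange := bot_le
  exact RingHom.mem_fieldRange.mp (hle h)

/-- Under the given isomorphisms, restriction is the surjection G/G_(i+1) → G/G_(i). -/
theorem IsGenericFamily.exists_lift (hD : IsGenericFamily F D) (i : Fin n)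
    (τ : GenericGal D i.castSucc) :
    ∃ σ : GenericGal D i.succ, ∀ s, σ (genericIncl i s) = genericIncl i (τ s) := by
  obtain ⟨iso, hiso⟩ := hD.compatible
  obtain ⟨y, hy⟩ : ∃ y, F.proj i y = iso i.castSucc τ := by
    obtain ⟨g, hg⟩ := QuotientGroup.mk_surjective (iso i.castSucc τ)
    exact ⟨QuotientGroup.mk g, hg⟩
  obtain ⟨τ', h1, h2⟩ := hiso i ((iso i.succ).symm y)
  rw [MulEquiv.apply_symm_apply, hy] at h2
  exact ⟨_, by rwa [← (iso i.castSucc).injective h2] at h1⟩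

/-- Two specializations of `S_i` that agree on `R_i` differ by an element of the Galois group. -/
theorem IsGenericFamily.exists_eq_specHom_comp (hD : IsGenericFamily F D) (α : Fin n → E)
    (i : Fin (n + 1)) (ψ : MvPolynomial (Fin i) (ZMod p) →+* E)
    (hψ : ∀ j, ψ (genericX D i j) = specHom α i (genericX D i j)) :
    ∃ σ : GenericGal D i, ∀ s, ψ s = specHom α i (σ s) := by
  have : CharP E p := charP_of_injective_algebraMap (algebraMap (ZMod p) E).injective p
  induction i using Fin.induction with
  | zero =>
    refine ⟨1, fun s => ?_⟩
    have : ψ = (specHom (p := p) α 0).toRingHom :=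
      MvPolynomial.ringHom_ext' (Subsingleton.elim _ _) fun j => Fin.elim0 j
    rw [this]
    rfl
  | succ i ih =>
    obtain ⟨τ, hτ⟩ := ih (ψ.comp (genericIncl (p := p) i).toRingHom) (by
      intro j
      rw [← specHom_genericIncl, genericIncl_genericX, ← hψ, ← genericIncl_genericX]
      rfl)
    obtain ⟨σ, hσ⟩ := hD.exists_lift i τ
    have hincl : ∀ s, ψ (genericIncl i s) = specHom α i.succ (σ (genericIncl i s)) := by
      intro s
      rw [hσ, specHom_genericIncl, ← hτ]
      rfl
    set Y : MvPolynomial (Fin i.succ) (ZMod p) := MvPolynomial.X (Fin.last (i : ℕ)) with hY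
    have h1 := (hψ (Fin.last (i : ℕ))).trans
      (congrArg (specHom α i.succ) (genericGal_genericX σ (Fin.last (i : ℕ))).symm)
    rw [genericX_last, ← hY] at h1
    simp only [map_sub, map_pow] at h1
    rw [hincl] at h1
    -- With σ lifting the automorphism found on S_i, the images of Y under ψ and under the
    -- specialization after σ solve the same Artin-Schreier equation. They differ by some c ∈ 𝔽_p,
    -- which a translation of Y corrects.
    obtain ⟨c, hc⟩ := exists_zmod_of_pow_eq_self (p := p) (x := ψ Y - specHom α i.succ (σ Y)) (by
      rw [sub_pow_char]
      linear_combination h1)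
    refine ⟨σ * translateAut D i c, fun s => ?_⟩
    have h2 : ψ = ((specHom (p := p) α i.succ).toRingHom.comp
        ((σ * translateAut D i c : GenericGal D i.succ) : _ →+* _)) := by
      refine MvPolynomial.ringHom_ext' (Subsingleton.elim _ _) fun j => ?_
      rcases Nat.lt_succ_iff_lt_or_eq.mp j.isLt with hj | hj
      · have h3 : (MvPolynomial.X j : MvPolynomial (Fin i.succ) (ZMod p)) =
            genericIncl i (MvPolynomial.X ⟨j, hj⟩) := by
          rw [genericIncl, MvPolynomial.rename_X]
          rfl
        rw [h3, hincl]
        change _ = specHom α i.succ (σ (translateAut D i c _))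
        rw [translateAut_apply, genericIncl, translateHom_rename i c le_rfl]
      · have h3 : j = Fin.last (i : ℕ) := Fin.ext hj
        rw [h3, ← hY]
        change _ = specHom α i.succ (σ (translateAut D i c Y))
        rw [translateAut_apply, hY, translateHom_last, map_add, map_add, ← hY]
        have h4 : σ (MvPolynomial.C c) = MvPolynomial.C c :=
          σ.commutes ⟨MvPolynomial.C c, (genericBase D i.succ).algebraMap_mem c⟩
        rw [h4, MvPolynomial.algHom_C, hc, add_sub_cancel]
    rw [h2]
    rfl

/-- Otherwise σ σ'⁻¹ would be nontrivial and move every s by an element of the kernel of the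
specialization, hence of a maximal ideal containing it, against the separation condition. -/
theorem IsGenericFamily.ext_of_specHom (hD : IsGenericFamily F D) (α : Fin n → E)
    (i : Fin (n + 1)) {σ σ' : GenericGal D i}
    (h : ∀ s, specHom α i (σ s) = specHom α i (σ' s)) : σ = σ' := by
  by_contra hne
  obtain ⟨M, hM, hle⟩ := Ideal.exists_le_maximal (RingHom.ker (specHom (p := p) α i))
    (RingHom.ker_ne_top _)
  obtain ⟨s, hs⟩ := (hD.galois i).separated M hM (σ * σ'⁻¹)
    (by rwa [Ne, mul_inv_eq_one])
  refine hs (hle ?_)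
  rw [RingHom.mem_ker, map_sub, sub_eq_zero]
  change specHom α i (σ (σ'.symm s)) = _
  rw [h, AlgEquiv.apply_symm_apply]

/-- The relation τ ∘ spec = spec ∘ σ determines σ ∈ Gal(S_i/R_i). Uniqueness makes τ ↦ σ
multiplicative and compatible with restriction, so the homomorphism at the top level induces all the
others. -/
theorem IsGenericFamily.exists_monoidHom (hD : IsGenericFamily F D) {K : Type*} [Field K]
    [Algebra K E] (α : Fin n → E)
    (hα : ∀ i j, specHom α i (genericX D i j) ∈ Set.range (algebraMap K E)) :
    ∃ μ : Gal(E/K) →* G, ∀ (i : Fin (n + 1)) (τ : Gal(E/K)),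
      μ τ ∈ F.sub i ↔ ∀ j : Fin n, (j : ℕ) < i → τ (α j) = α j := by
  have hex : ∀ (i : Fin (n + 1)) (τ : Gal(E/K)), ∃ σ : GenericGal D i,
      ∀ s, τ (specHom α i s) = specHom α i (σ s) := by
    intro i τ
    refine hD.exists_eq_specHom_comp α i ((τ : E →+* E).comp (specHom (p := p) α i).toRingHom) ?_
    intro j
    obtain ⟨c, hc⟩ := hα i j
    change τ (specHom α i _) = _
    rw [← hc, AlgEquiv.commutes]
  choose g hg using hex
  have hg_one : ∀ i, g i 1 = 1 := fun i =>
    hD.ext_of_specHom α i fun s => by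
      rw [← hg]
      rfl
  have hg_mul : ∀ i τ τ', g i (τ * τ') = g i τ * g i τ' := fun i τ τ' =>
    hD.ext_of_specHom α i fun s => by
      rw [← hg, AlgEquiv.mul_apply, hg, hg, AlgEquiv.mul_apply]
  obtain ⟨iso, hiso⟩ := hD.compatible
  have hproj : ∀ (i : Fin n) τ, F.proj i (iso i.succ (g i.succ τ)) =
      iso i.castSucc (g i.castSucc τ) := by
    intro i τ
    obtain ⟨τ', h1, h2⟩ := hiso i (g i.succ τ)
    rw [h2]
    congr 1
    refine hD.ext_of_specHom α _ fun s => ?_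
    rw [← hg, ← specHom_genericIncl, ← h1, ← hg, specHom_genericIncl]
  let e : G ⧸ F.sub (Fin.last n) ≃* G :=
    (QuotientGroup.quotientMulEquivOfEq F.sub_last).trans QuotientGroup.quotientBot
  have he : ∀ x, (QuotientGroup.mk (e x) : G ⧸ F.sub (Fin.last n)) = x := by
    intro x
    obtain ⟨y, rfl⟩ := QuotientGroup.mk_surjective x
    rfl
  let μ : Gal(E/K) →* G := e.toMonoidHom.comp ((iso (Fin.last n)).toMonoidHom.comp
    { toFun := g (Fin.last n), map_one' := hg_one _, map_mul' := hg_mul _ })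
  have hμ : ∀ i τ, (QuotientGroup.mk (μ τ) : G ⧸ F.sub i) = iso i (g i τ) := by
    intro i τ
    induction i using Fin.reverseInduction with
    | last => exact he _
    | cast i ih =>
      rw [← hproj, ← ih]
      rfl
  refine ⟨μ, fun i τ => ?_⟩
  rw [← QuotientGroup.eq_one_iff, hμ, map_eq_one_iff _ (iso i).injective]
  constructor
  · intro h j hj
    have := hg i τ (MvPolynomial.X ⟨j, hj⟩)
    rw [h, AlgEquiv.one_apply, specHom, MvPolynomial.aeval_X] at this
    exact this
  · intro h
    refine hD.ext_of_specHom α i fun s => ?_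
    rw [← hg, AlgEquiv.one_apply]
    have : ((τ : E →+* E).comp (specHom (p := p) α i).toRingHom) = (specHom (p := p) α i).toRingHom := by
      refine MvPolynomial.ringHom_ext' (Subsingleton.elim _ _) fun j => ?_
      change τ (specHom α i _) = specHom α i _
      rw [specHom, MvPolynomial.aeval_X]
      exact h _ j.isLt
    exact DFunLike.congr_fun this s

end Specialization

/-! ### The valuation of a local field -/

section LocalField

variable {K : Type*} [Field K] [Valued K ℤᵐ⁰] [IsLocalFieldPerfectResidue K]
  {Ω : Type*} [Field Ω] [Algebra K Ω] [Algebra.IsAlgebraic K Ω]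

theorem extVal_algebraMap {c : K} (hc : c ≠ 0) :
    extVal K (algebraMap K Ω c) =
      (((-WithZero.log (Valued.v c) : ℤ) : ℝ) : WithTop ℝ) := by
  change extOrd K (algebraMap K Ω c) = _
  rw [extOrd, if_neg (by simpa using hc), minpoly.eq_X_sub_C]
  simp

theorem extVal_algHom (σ : Ω →ₐ[K] Ω) (x : Ω) : extVal K (σ x) = extVal K x := by
  change extOrd K (σ x) = extOrd K x
  by_cases hx : x = 0
  · rw [hx, map_zero]
  · rw [extOrd, extOrd, if_neg hx, if_neg (by simpa using hx), minpoly.algHom_eq σ σ.injective]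

theorem exists_extVal_algebraMap_eq (Ω : Type*) [Field Ω] [Algebra K Ω]
    [Algebra.IsAlgebraic K Ω] (l : ℤ) :
    ∃ y : K, extVal K (algebraMap K Ω y) = ((l : ℝ) : WithTop ℝ) := by
  obtain ⟨y, hy⟩ := IsLocalFieldPerfectResidue.normalized (K := K) (WithZero.exp (-l))
  have hy0 : y ≠ 0 := by
    rintro rfl
    rw [map_zero] at hy
    exact WithZero.exp_ne_zero hy.symm
  refine ⟨y, ?_⟩
  rw [extVal_algebraMap hy0, hy, WithZero.log_exp, neg_neg]

theorem isTotRamOfLevel_bot (p : ℕ) :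
    IsTotRamOfLevel (extVal K (Ω := Ω)) p 0 (⊥ : IntermediateField K Ω) where
  discrete := by
    intro x hx hx0
    obtain ⟨c, rfl⟩ := IntermediateField.mem_bot.mp hx
    refine ⟨-WithZero.log (Valued.v c), ?_⟩
    rw [extVal_algebraMap (by rintro rfl; simp at hx0), pow_zero, div_one]
  attained := by
    intro k
    obtain ⟨y, hy⟩ := exists_extVal_algebraMap_eq (K := K) Ω k
    exact ⟨_, IntermediateField.algebraMap_mem _ y, by rw [hy, pow_zero, div_one]⟩
  residue := by
    intro x hx _
    obtain ⟨c, rfl⟩ := IntermediateField.mem_bot.mp hx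
    refine ⟨c, ?_⟩
    rw [sub_self, AddValuation.map_zero]
    exact WithTop.coe_lt_top 0

/-- The residue of the unit c is a p-th power in the perfect residue field, and d lifts its root. -/
theorem exists_extVal_sub_pow_pos {p : ℕ} [hp : Fact p.Prime] [CharP K p] (c : K)
    (hc : extVal K (algebraMap K Ω c) = 0) :
    ∃ d : K, 0 < extVal K (algebraMap K Ω c - algebraMap K Ω d ^ p) := by
  have hc0 : c ≠ 0 := by
    rintro rfl
    simp at hc
  have hv0 : (Valued.v c : ℤᵐ⁰) ≠ 0 := by simpa using hc0
  have hvc : (Valued.v c : ℤᵐ⁰) = 1 := by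
    rw [extVal_algebraMap hc0, ← WithTop.coe_zero, WithTop.coe_inj] at hc
    have h : WithZero.log (Valued.v c : ℤᵐ⁰) = 0 := by
      have : -WithZero.log (Valued.v c : ℤᵐ⁰) = 0 := by exact_mod_cast hc
      omega
    rw [← WithZero.exp_log hv0, h, WithZero.exp_zero]
  have hperf : PerfectField (Valued.ResidueField K) := IsLocalFieldPerfectResidue.perfect
  have hchar : CharP (Valued.ResidueField K) p := by
    rw [CharP.charP_iff_prime_eq_zero hp.out]
    have h : ((p : ℕ) : Valued.integer K) = 0 := by
      apply Subtype.ext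
      push_cast
      exact CharP.cast_eq_zero K p
    rw [← map_natCast (IsLocalRing.residue (Valued.integer K)), h, map_zero]
  have : ExpChar (Valued.ResidueField K) p := ExpChar.prime hp.out
  have : PerfectRing (Valued.ResidueField K) p := PerfectField.toPerfectRing p
  let C : Valued.integer K := ⟨c, hvc.le⟩
  obtain ⟨y, hy⟩ := surjective_frobenius (Valued.ResidueField K) p
    (IsLocalRing.residue (Valued.integer K) C)
  obtain ⟨d, rfl⟩ := IsLocalRing.residue_surjective y
  rw [frobenius_def, ← map_pow, eq_comm, ← sub_eq_zero, ← map_sub,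
    IsLocalRing.residue_eq_zero_iff] at hy
  refine ⟨d, ?_⟩
  rw [← map_pow, ← map_sub]
  have hlt : (Valued.v (c - (d : K) ^ p) : ℤᵐ⁰) < 1 := by
    have h2 := mt (Valuation.Integers.isUnit_iff_valuation_eq_one
      (Valuation.integer.integers (Valued.v : Valuation K ℤᵐ⁰)) (x := C - d ^ p)).mpr
      ((IsLocalRing.mem_maximalIdeal _).mp hy)
    exact lt_of_le_of_ne (C - d ^ p).2 h2
  rcases eq_or_ne (c - (d : K) ^ p) 0 with h0 | h0
  · rw [h0, map_zero, AddValuation.map_zero]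
    exact WithTop.coe_lt_top 0
  · rw [extVal_algebraMap h0, ← WithTop.coe_zero, WithTop.coe_lt_coe]
    have h3 : WithZero.log (Valued.v (c - (d : K) ^ p) : ℤᵐ⁰) < 0 := by
      rw [← WithZero.log_one]
      exact (WithZero.log_lt_log (by simpa using h0) one_ne_zero).mpr hlt
    have h4 : 0 < -WithZero.log (Valued.v (c - (d : K) ^ p) : ℤᵐ⁰) := by omega
    exact_mod_cast h4

end LocalField

/-! ### Generators of an Artin-Schreier extension -/

/-- Division with remainder by the monic polynomial T^p - T - (z^p - z), whose irreducibility is not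
needed. -/
theorem IntermediateField.exists_sum_pow_of_mem_adjoin {K Ω : Type*} [Field K] [Field Ω]
    [Algebra K Ω] {p : ℕ} (hp : 1 < p) {M : IntermediateField K Ω} {z : Ω} (hz : z ^ p - z ∈ M)
    {x : Ω} (hx : x ∈ IntermediateField.adjoin M {z}) :
    ∃ c : ℕ → Ω, (∀ k, c k ∈ M) ∧ x = ∑ k ∈ Finset.range p, c k * z ^ k := by
  let A : M := ⟨z ^ p - z, hz⟩
  let f : Polynomial M := Polynomial.X ^ p - (Polynomial.X + Polynomial.C A)
  have hdeg : (Polynomial.X + Polynomial.C A).degree < (p : WithBot ℕ) := by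
    rw [Polynomial.degree_X_add_C]
    exact_mod_cast hp
  have hf : f.Monic := Polynomial.monic_X_pow_sub hdeg
  have hfp : f.natDegree = p := by
    refine Polynomial.natDegree_eq_of_degree_eq_some ?_
    rw [Polynomial.degree_sub_eq_left_of_degree_lt] <;> rw [Polynomial.degree_X_pow]
    exact hdeg
  have hfz : Polynomial.aeval z f = 0 := by
    simp only [f, map_sub, map_add, map_pow, Polynomial.aeval_X, Polynomial.aeval_C]
    change z ^ p - (z + (z ^ p - z)) = 0
    ring
  have hint : IsIntegral M z := ⟨f, hf, by rwa [← Polynomial.aeval_def]⟩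
  have hx' : x ∈ (IntermediateField.adjoin M {z}).toSubalgebra := hx
  rw [IntermediateField.adjoin_simple_toSubalgebra_of_isAlgebraic hint.isAlgebraic,
    Algebra.adjoin_singleton_eq_range_aeval] at hx'
  obtain ⟨q, rfl⟩ := hx'
  refine ⟨fun k => ((q %ₘ f).coeff k : M), fun k => SetLike.coe_mem _, ?_⟩
  have hq : (q %ₘ f).natDegree < p := by
    rw [← hfp]
    refine Polynomial.natDegree_modByMonic_lt q hf ?_
    intro h1
    rw [h1, Polynomial.natDegree_one] at hfp
    omega
  have h := Polynomial.aeval_eq_sum_range' hq z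
  rw [Polynomial.aeval_modByMonic_eq_self_of_root hfz] at h
  exact h

/-! ### The tower -/

section Tower

variable {p n : ℕ} {K : Type*} [Field K] {Ω : Type*} [Field Ω] [Algebra K Ω] {α : Fin n → Ω}

theorem tower_zero : tower K α 0 = ⊥ := by
  rw [tower, IntermediateField.adjoin_eq_bot_iff]
  rintro x ⟨j, hj, -⟩
  exact absurd hj (Nat.not_lt_zero _)

theorem tower_mono {i j : ℕ} (h : i ≤ j) : tower K α i ≤ tower K α j :=
  IntermediateField.adjoin.mono K _ _ fun _ ⟨k, hk, hx⟩ => ⟨k, hk.trans_le h, hx⟩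

theorem mem_tower {i : ℕ} (j : Fin n) (h : (j : ℕ) < i) : α j ∈ tower K α i :=
  IntermediateField.subset_adjoin K _ ⟨j, h, rfl⟩

theorem specialize_mem_tower [CharP K p] (D : (i : Fin n) → MvPolynomial (Fin i) (ZMod p))
    (i : Fin n) : specialize K D α i ∈ tower K α i := by
  rw [specialize, MvPolynomial.eval₂_eq']
  have hmem : ∀ j : Fin i, α (Fin.castLE i.isLt.le j) ∈ tower K α i := fun j =>
    mem_tower (Fin.castLE i.isLt.le j) j.isLt
  refine sum_mem fun d _ => mul_mem ?_ (prod_mem fun j _ => pow_mem (hmem j) _)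
  exact (tower K α i).algebraMap_mem (ZMod.castHom dvd_rfl K (MvPolynomial.coeff d (D i)))

theorem exists_sum_pow_of_mem_tower_succ (hp : 1 < p) (i : Fin n) {z : Ω}
    (hz : z ^ p - z ∈ tower K α i) (hsub : α i - z ∈ tower K α i) {x : Ω}
    (hx : x ∈ tower K α (i + 1)) :
    ∃ c : ℕ → Ω, (∀ k, c k ∈ tower K α i) ∧ x = ∑ k ∈ Finset.range p, c k * z ^ k := by
  refine IntermediateField.exists_sum_pow_of_mem_adjoin hp hz ?_
  have h : tower K α (i + 1) ≤
      (IntermediateField.adjoin (tower K α i) {z}).restrictScalars K := by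
    rw [tower, IntermediateField.adjoin_le_iff]
    have hM : ∀ y ∈ tower K α i, y ∈ IntermediateField.adjoin (tower K α i) {z} := fun y hy =>
      IntermediateField.algebraMap_mem (IntermediateField.adjoin (tower K α i) {z})
        (⟨y, hy⟩ : tower K α i)
    rintro _ ⟨j, hj, rfl⟩
    change α j ∈ IntermediateField.adjoin (tower K α i) {z}
    rcases Nat.lt_succ_iff_lt_or_eq.mp hj with hj | hj
    · exact hM _ (mem_tower _ hj)
    · rw [Fin.ext hj, ← sub_add_cancel (α i) z]
      exact add_mem (hM _ hsub) (IntermediateField.mem_adjoin_simple_self _ _)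
  exact h hx

/-- `σ` fixes the tower up to level `i` if it fixes the generators. -/
theorem algHom_eq_of_mem_tower {E : Type*} [Field E] [Algebra K E] {i : ℕ} {σ τ : Ω →ₐ[K] E}
    (h : ∀ j : Fin n, (j : ℕ) < i → σ (α j) = τ (α j)) {x : Ω} (hx : x ∈ tower K α i) :
    σ x = τ x := by
  have hle : tower K α i ≤ { AlgHom.equalizer σ τ with
      inv_mem' := fun x (hx : σ x = τ x) => show σ x⁻¹ = τ x⁻¹ by rw [map_inv₀, map_inv₀, hx] } := by
    rw [tower, IntermediateField.adjoin_le_iff]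
    rintro _ ⟨j, hj, rfl⟩
    exact h j hj
  exact hle hx

end Tower

/-! ### Upper and lower break sequences -/

/-- The relation between the upper breaks `u` and the lower breaks `b`. -/
structure IsBreakSeq (p : ℕ) {n : ℕ} (u : Fin n → ℕ) (b : Fin n → ℤ) : Prop where
  strictMono : StrictMono u
  pos : ∀ i, 0 < u i
  not_dvd : ∀ i, ¬ p ∣ u i
  zero : ∀ h : 0 < n, b ⟨0, h⟩ = u ⟨0, h⟩
  succ : ∀ (i : ℕ) (h : i + 1 < n), b ⟨i + 1, h⟩ - b ⟨i, Nat.lt_of_succ_lt h⟩ =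
    (p : ℤ) ^ (i + 1) * ((u ⟨i + 1, h⟩ : ℤ) - u ⟨i, Nat.lt_of_succ_lt h⟩)

namespace IsBreakSeq

variable {p n : ℕ} {u : Fin n → ℕ} {b : Fin n → ℤ}

/-- All increments of b are divisible by p, so every lower break is congruent to u_0 modulo p. -/
theorem lower_not_dvd (h : IsBreakSeq p u b) (i : Fin n) : ¬ (p : ℤ) ∣ b i := by
  obtain ⟨i, hi⟩ := i
  induction i with
  | zero =>
    rw [h.zero hi]
    exact_mod_cast h.not_dvd _
  | succ i ih =>
    intro hdvd
    refine ih (Nat.lt_of_succ_lt hi) ?_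
    have h1 := h.succ i hi
    have h2 : (p : ℤ) ∣ b ⟨i + 1, hi⟩ - b ⟨i, Nat.lt_of_succ_lt hi⟩ := by
      rw [h1]
      exact dvd_mul_of_dvd_left (dvd_pow_self _ (Nat.succ_ne_zero i)) _
    exact (dvd_sub_right hdvd).mp h2

variable [hp : Fact p.Prime]

theorem lt_succ (h : IsBreakSeq p u b) (i : ℕ) (hi : i + 1 < n) :
    b ⟨i, Nat.lt_of_succ_lt hi⟩ < b ⟨i + 1, hi⟩ := by
  have h1 := h.succ i hi
  have h2 : u ⟨i, Nat.lt_of_succ_lt hi⟩ < u ⟨i + 1, hi⟩ := h.strictMono (Nat.lt_succ_self i)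
  have h3 : (0 : ℤ) < (p : ℤ) ^ (i + 1) := pow_pos (by exact_mod_cast hp.out.pos) _
  have h4 : (0 : ℤ) < (u ⟨i + 1, hi⟩ : ℤ) - u ⟨i, Nat.lt_of_succ_lt hi⟩ := by omega
  have := mul_pos h3 h4
  omega

theorem lower_strictMono (h : IsBreakSeq p u b) : StrictMono b := by
  have key : ∀ i j : ℕ, i < j → ∀ (hi : i < n) (hj : j < n), b ⟨i, hi⟩ < b ⟨j, hj⟩ := by
    intro i j hij
    induction j, hij using Nat.le_induction with
    | base => exact fun _ hj => h.lt_succ i hj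
    | succ j _ ih => exact fun hi hj => (ih hi (Nat.lt_of_succ_lt hj)).trans (h.lt_succ j hj)
  exact fun i j hij => key i j hij i.isLt j.isLt

theorem lower_pos (h : IsBreakSeq p u b) (i : Fin n) : 0 < b i := by
  have h0 : 0 < n := i.pos
  have h1 : b ⟨0, h0⟩ ≤ b i := h.lower_strictMono.monotone (Nat.zero_le _)
  have h2 := h.pos ⟨0, h0⟩
  rw [h.zero h0] at h1
  omega

/-- This turns the bound v(d_i) > -b_i/p^i into v(d_i) > -u_i, so that a_i dominates the equation of
α_i. -/
theorem lower_le (h : IsBreakSeq p u b) (i : Fin n) : b i ≤ (p : ℤ) ^ (i : ℕ) * u i := by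
  obtain ⟨i, hi⟩ := i
  induction i with
  | zero => simp [h.zero hi]
  | succ i ih =>
    have h1 := h.succ i hi
    have h2 := ih (Nat.lt_of_succ_lt hi)
    have h3 : (p : ℤ) ^ i ≤ (p : ℤ) ^ (i + 1) :=
      pow_le_pow_right₀ (by exact_mod_cast hp.out.one_lt.le) (Nat.le_succ i)
    have h4 : (p : ℤ) ^ i * u ⟨i, Nat.lt_of_succ_lt hi⟩ ≤
        (p : ℤ) ^ (i + 1) * u ⟨i, Nat.lt_of_succ_lt hi⟩ :=
      mul_le_mul_of_nonneg_right h3 (by positivity)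
    simp only at h2 ⊢
    linarith

end IsBreakSeq

/-! ### Reduced generators of the tower and displacement along it -/

section ReducedTower

variable {p n : ℕ} {K : Type*} [Field K] {Ω : Type*} [Field Ω] [Algebra K Ω]

/-- `z` generates `K_(i+1)` over `K_i` by an Artin-Schreier equation whose right hand side has
valuation `-b_i`, prime to `p`, with respect to the normalized valuation of `K_i`. -/
structure IsReducedGenerator (v : AddValuation Ω (WithTop ℝ)) (p : ℕ) (α : Fin n → Ω)
    (b : Fin n → ℤ) (i : Fin n) (z : Ω) : Prop where
  sub_mem : α i - z ∈ tower K α i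
  pow_sub_mem : z ^ p - z ∈ tower K α i
  val_pow_sub : v (z ^ p - z) = ((-b i / p ^ (i : ℕ) : ℝ) : WithTop ℝ)
  val : v z = ((-b i / p ^ ((i : ℕ) + 1) : ℝ) : WithTop ℝ)

theorem IsReducedGenerator.mem {v : AddValuation Ω (WithTop ℝ)} {α : Fin n → Ω} {b : Fin n → ℤ}
    {i : Fin n} {z : Ω} (h : IsReducedGenerator (K := K) v p α b i z) :
    z ∈ tower K α (i + 1) := by
  have h1 := _root_.sub_mem (mem_tower (K := K) i (Nat.lt_succ_self i))
    (tower_mono (Nat.le_succ i) h.sub_mem)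
  rwa [sub_sub_cancel] at h1

/-- The tower `K_0 ⊆ ⋯ ⊆ K_n` is totally ramified, with reduced generators. -/
structure IsReducedTower (v : AddValuation Ω (WithTop ℝ)) (p : ℕ) (α : Fin n → Ω)
    (b : Fin n → ℤ) : Prop where
  level : ∀ m ≤ n, IsTotRamOfLevel v p m (tower K α m)
  generator : ∀ i, ∃ z, IsReducedGenerator (K := K) v p α b i z

variable [hp : Fact p.Prime] {v : AddValuation Ω (WithTop ℝ)} {u : Fin n → ℕ}
  {b : Fin n → ℤ} {α : Fin n → Ω}

/-- The valuation of the generators `α_i`. -/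
theorem val_generator (hb : IsBreakSeq p u b) {i : Fin n} {a : K}
    (ha : v (algebraMap K Ω a) = ((-(u i : ℝ) : ℝ) : WithTop ℝ)) {d x : Ω}
    (hdv : ((-(b i / p ^ (i : ℕ)) : ℝ) : WithTop ℝ) < v d)
    (hx : x ^ p - x = d + algebraMap K Ω a) : v x = ((-(u i / p) : ℝ) : WithTop ℝ) := by
  have hp0 : (0 : ℝ) < p := by exact_mod_cast hp.out.pos
  have hu : (0 : ℝ) < u i := by exact_mod_cast hb.pos i
  have h1 : (b i : ℝ) ≤ p ^ (i : ℕ) * u i := by exact_mod_cast hb.lower_le i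
  have h2 : v (x ^ p - x) = ((-(u i : ℝ) : ℝ) : WithTop ℝ) := by
    rw [hx, add_comm]
    refine AddValuation.add_eq_coe_of_lt ha (lt_of_le_of_lt ?_ hdv)
    rw [WithTop.coe_le_coe, neg_le_neg_iff, div_le_iff₀ (pow_pos hp0 _)]
    linarith
  rw [AddValuation.eq_of_artinSchreier hp.out.one_lt (neg_neg_of_pos hu) h2, neg_div]

variable [CharP Ω p]

/-- Reduction of an element of `K` modulo Artin-Schreier elements `γ ^ p - γ` of `K_k`. -/
theorem exists_tower_reduction (hb : IsBreakSeq p u b)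
    (hperf : ∀ c : K, v (algebraMap K Ω c) = 0 →
      ∃ d : K, 0 < v (algebraMap K Ω c - algebraMap K Ω d ^ p))
    (i : Fin n) (hlev : ∀ k ≤ (i : ℕ), IsTotRamOfLevel v p k (tower K α k))
    (hgen : ∀ j < i, ∃ z, IsReducedGenerator (K := K) v p α b j z)
    {a : K} (ha : v (algebraMap K Ω a) = ((-(u i : ℝ) : ℝ) : WithTop ℝ)) (k : ℕ) (hk : k ≤ i) :
    ∃ γ ∈ tower K α k, v (algebraMap K Ω a - (γ ^ p - γ)) =
      ((-(b ⟨k, hk.trans_lt i.isLt⟩ + p ^ k * (u i - u ⟨k, hk.trans_lt i.isLt⟩) : ℤ) / p ^ k : ℝ) :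
        WithTop ℝ) := by
  induction k with
  | zero =>
    refine ⟨0, zero_mem _, ?_⟩
    rw [zero_pow hp.out.ne_zero, sub_zero, sub_zero, ha, hb.zero i.pos]
    congr 1
    push_cast
    simp
  | succ k ih =>
    have hkn : k + 1 < n := hk.trans_lt i.isLt
    obtain ⟨γ, hγ, hγv⟩ := ih (Nat.le_of_succ_le hk)
    obtain ⟨z, hz⟩ := hgen ⟨k, Nat.lt_of_succ_lt hkn⟩ hk
    have hu : u ⟨k, Nat.lt_of_succ_lt hkn⟩ < u i := hb.strictMono hk
    have hp0 : (0 : ℤ) < p := by exact_mod_cast hp.out.pos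
    have hu' : (0 : ℤ) < (u i : ℤ) - u ⟨k, Nat.lt_of_succ_lt hkn⟩ := by omega
    -- The current pole order is prime to p: it equals u_i at k = 0 and is congruent to b_k modulo p
    -- afterwards.
    have hdvd : ¬ (p : ℤ) ∣ b ⟨k, Nat.lt_of_succ_lt hkn⟩ +
        p ^ k * (u i - u ⟨k, Nat.lt_of_succ_lt hkn⟩) := by
      rcases k with _ | k
      · rw [hb.zero i.pos, pow_zero, one_mul, add_sub_cancel]
        exact_mod_cast hb.not_dvd i
      · intro hdvd
        exact hb.lower_not_dvd _ ((dvd_add_left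
          (dvd_mul_of_dvd_left (dvd_pow_self _ (Nat.succ_ne_zero k)) _)).mp hdvd)
    -- From c = b_k + p^k (u_i - u_k) one gets pc - (p-1) b_k = b_k + p^(k+1) (u_i - u_k), which the
    -- recursion for b rewrites in terms of k + 1.
    obtain ⟨δ, hδ, hδv⟩ := (hlev k (Nat.le_of_succ_le hk)).exists_reduction_eq hperf
      (tower_mono (Nat.le_succ k)) hz.mem hz.pow_sub_mem hz.val_pow_sub hz.val (hb.lower_pos _)
      (hb.lower_not_dvd _) (lt_add_of_pos_right _ (mul_pos (pow_pos hp0 k) hu')) hdvd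
      (sub_mem (IntermediateField.algebraMap_mem _ a) (sub_mem (pow_mem hγ p) hγ)) hγv
    refine ⟨γ + δ, add_mem (tower_mono (Nat.le_succ k) hγ) hδ, ?_⟩
    rw [add_pow_char, show algebraMap K Ω a - (γ ^ p + δ ^ p - (γ + δ)) =
      algebraMap K Ω a - (γ ^ p - γ) - (δ ^ p - δ) by ring, hδv]
    congr 2
    have h1 := hb.succ k hkn
    have h2 : (b ⟨k + 1, hkn⟩ : ℝ) = b ⟨k, Nat.lt_of_succ_lt hkn⟩ +
        (p : ℝ) ^ (k + 1) * (u ⟨k + 1, hkn⟩ - u ⟨k, Nat.lt_of_succ_lt hkn⟩) := by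
      rw [sub_eq_iff_eq_add'] at h1
      exact_mod_cast h1
    push_cast
    rw [h2]
    ring

/-- Induction on the level. The generators below m reduce the pole of a_m to order b_m in K_m,
adding d_m does not change it, and α_m - γ is the next generator; its valuation makes K_{m+1}
totally ramified of the next level. -/
theorem isReducedTower (hb : IsBreakSeq p u b)
    (hbot : IsTotRamOfLevel v p 0 (⊥ : IntermediateField K Ω))
    (hperf : ∀ c : K, v (algebraMap K Ω c) = 0 →
      ∃ d : K, 0 < v (algebraMap K Ω c - algebraMap K Ω d ^ p))
    {a : Fin n → K} (ha : ∀ i, v (algebraMap K Ω (a i)) = ((-(u i : ℝ) : ℝ) : WithTop ℝ))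
    {d : Fin n → Ω} (hd : ∀ i : Fin n, d i ∈ tower K α i)
    (hdv : ∀ i, ((-(b i / p ^ (i : ℕ)) : ℝ) : WithTop ℝ) < v (d i))
    (hα : ∀ i, α i ^ p - α i = d i + algebraMap K Ω (a i)) :
    IsReducedTower (K := K) v p α b := by
  have hp0 : (0 : ℝ) < p := by exact_mod_cast hp.out.pos
  have key : ∀ m ≤ n, (∀ k ≤ m, IsTotRamOfLevel v p k (tower K α k)) ∧
      ∀ j : Fin n, (j : ℕ) < m → ∃ z, IsReducedGenerator (K := K) v p α b j z := by
    intro m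
    induction m with
    | zero =>
      intro _
      refine ⟨fun k hk => ?_, fun j hj => absurd hj (Nat.not_lt_zero _)⟩
      rw [Nat.le_zero.mp hk, tower_zero]
      exact hbot
    | succ m ih =>
      intro hm
      obtain ⟨hlev, hgen⟩ := ih (Nat.le_of_succ_le hm)
      set i : Fin n := ⟨m, hm⟩ with hi
      have hbi : (0 : ℝ) < b i := by exact_mod_cast hb.lower_pos i
      obtain ⟨γ, hγ, hγv⟩ := exists_tower_reduction hb hperf i hlev (fun j hj => hgen j hj) (ha i) m
        le_rfl
      rw [← hi, sub_self, mul_zero, add_zero] at hγv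
      have h1 : (α i - γ) ^ p - (α i - γ) =
          algebraMap K Ω (a i) - (γ ^ p - γ) + d i := by
        rw [sub_pow_char]
        linear_combination hα i
      have h2 : v ((α i - γ) ^ p - (α i - γ)) = ((-b i / p ^ m : ℝ) : WithTop ℝ) := by
        rw [h1]
        refine AddValuation.add_eq_coe_of_lt hγv ?_
        rw [neg_div]
        exact hdv i
      have hz : IsReducedGenerator (K := K) v p α b i (α i - γ) := by
        refine ⟨?_, ?_, h2, ?_⟩
        · rwa [sub_sub_cancel]
        · rw [h1]
          exact add_mem (sub_mem (IntermediateField.algebraMap_mem _ _)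
            (sub_mem (pow_mem hγ p) hγ)) (hd i)
        · rw [AddValuation.eq_of_artinSchreier hp.out.one_lt
            (div_neg_of_neg_of_pos (neg_neg_of_pos hbi) (pow_pos hp0 m)) h2, div_div, ← pow_succ]
      refine ⟨fun k hk => ?_, fun j hj => ?_⟩
      · rcases Nat.le_succ_iff.mp hk with hk | rfl
        · exact hlev k hk
        · exact (hlev m le_rfl).succ (tower_mono (Nat.le_succ m)) hz.mem hz.val
            (hb.lower_not_dvd i) fun x hx =>
              exists_sum_pow_of_mem_tower_succ hp.out.one_lt i hz.pow_sub_mem hz.sub_mem hx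
      · rcases Nat.lt_succ_iff_lt_or_eq.mp hj with hj | hj
        · exact hgen j hj
        · rw [show j = i from Fin.ext hj]
          exact ⟨_, hz⟩
  exact ⟨fun m hm => (key m hm).1 m le_rfl, fun i => (key n le_rfl).2 i i.isLt⟩

/-- In K_{i+1} the displacement comes from σ fixing K_i and moving z_i. Each later break is larger
than b_i, so a further level only divides the displacement by p, that is, preserves it in normalised
units. -/
theorem IsReducedTower.displacesBy (h : IsReducedTower (K := K) v p α b) (hb : IsBreakSeq p u b)
    (hK : ∀ l : ℤ, ∃ y : K, v (algebraMap K Ω y) = ((l : ℝ) : WithTop ℝ))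
    {σ : Ω →ₐ[K] Ω} (hσ : ∀ x, v (σ x) = v x) {i : Fin n}
    (hfix : ∀ j < i, σ (α j) = α j) (hmove : σ (α i) ≠ α i) (m : ℕ) (him : (i : ℕ) < m)
    (hm : m ≤ n) : DisplacesBy v p m (tower K α m) σ (b i / p ^ m) := by
  induction m, him using Nat.le_induction with
  | base =>
    obtain ⟨z, hz⟩ := h.generator i
    have hid : ∀ x ∈ tower K α i, σ x = x := fun x hx =>
      algHom_eq_of_mem_tower (τ := AlgHom.id K Ω) hfix hx
    refine .of_fixed (h.level _ hm) hK hz.mem hz.val (hb.lower_not_dvd i) (hb.lower_pos i) hσ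
      (hid _ hz.pow_sub_mem) ?_
    intro hσz
    refine hmove ?_
    have h1 := hid _ hz.sub_mem
    rw [map_sub, hσz] at h1
    exact sub_left_inj.mp h1
  | succ m him ih =>
    obtain ⟨z, hz⟩ := h.generator ⟨m, hm⟩
    exact .succ (h.level _ hm) hK hz.mem hz.val (hb.lower_not_dvd _) hσ hz.pow_sub_mem
      hz.val_pow_sub (hb.lower_pos i) (hb.lower_strictMono him) (ih (Nat.le_of_succ_le hm))

end ReducedTower

/-! ### The Galois group of the tower -/

section TowerGalois

variable {p n : ℕ} {K : Type*} [Field K] {Ω : Type*} [Field Ω] [Algebra K Ω] {α : Fin n → Ω}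

/-- The generator `α_j` as an element of `K_n`. -/
def towerGen (K : Type*) [Field K] [Algebra K Ω] (α : Fin n → Ω) (j : Fin n) : tower K α n :=
  ⟨α j, mem_tower j j.isLt⟩

theorem towerGen_fixed_iff {τ : Gal(tower K α n/K)} {j : Fin n} :
    τ (towerGen K α j) = towerGen K α j ↔ (τ (towerGen K α j) : Ω) = α j :=
  Subtype.ext_iff

instance finiteDimensional_tower [Algebra.IsAlgebraic K Ω] (i : ℕ) :
    FiniteDimensional K (tower K α i) := by
  have : Finite {x | ∃ j : Fin n, (j : ℕ) < i ∧ α j = x} :=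
    (Set.finite_range α).subset (by rintro _ ⟨j, -, rfl⟩; exact ⟨j, rfl⟩)
  exact IntermediateField.finiteDimensional_adjoin fun x _ => Algebra.IsIntegral.isIntegral x

/-- The displacement estimates concern endomorphisms of Ω; this extension makes them apply to
Gal(K_n/K). -/
theorem exists_algHom_extending [Normal K Ω] (τ : Gal(tower K α n/K)) :
    ∃ σ : Ω →ₐ[K] Ω, ∀ x : tower K α n, σ x = (τ x : Ω) :=
  ⟨(τ.liftNormal Ω : Ω ≃ₐ[K] Ω), fun x => AlgEquiv.liftNormal_commutes τ Ω x⟩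

theorem mem_towerGal_iff [Normal K Ω] {τ : Gal(tower K α n/K)} {i : ℕ} :
    τ ∈ towerGal K α i ↔
      ∀ j : Fin n, (j : ℕ) < i → τ (towerGen K α j) = towerGen K α j := by
  rw [towerGal, IntermediateField.mem_fixingSubgroup_iff]
  constructor
  · intro h j hj
    exact h _ ((IntermediateField.mem_restrict _ _).mpr (mem_tower j hj))
  · intro h x hx
    have hx' : (x : Ω) ∈ tower K α i := (IntermediateField.mem_restrict _ _).mp hx
    obtain ⟨σ, hσ⟩ := exists_algHom_extending τ
    have h1 := algHom_eq_of_mem_tower (σ := σ) (τ := AlgHom.id K Ω) (α := α) (i := i) (by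
      intro j hj
      have h2 := hσ (towerGen K α j)
      rw [h j hj] at h2
      exact h2) hx'
    rw [hσ] at h1
    exact Subtype.ext h1

theorem eq_one_of_fixes_towerGen [Normal K Ω] {τ : Gal(tower K α n/K)}
    (h : ∀ j : Fin n, τ (towerGen K α j) = towerGen K α j) : τ = 1 := by
  have h1 : τ ∈ towerGal K α n := mem_towerGal_iff.mpr fun j _ => h j
  rw [towerGal, IntermediateField.mem_fixingSubgroup_iff] at h1
  ext x
  rw [h1 x ((IntermediateField.mem_restrict _ _).mpr x.2)]
  rfl

theorem specHom_genericX [Fact p.Prime] [CharP K p] [Algebra (ZMod p) Ω]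
    (D : (i : Fin n) → MvPolynomial (Fin i) (ZMod p)) {a : Fin n → K}
    (hα : ∀ i, α i ^ p - α i = specialize K D α i + algebraMap K Ω (a i)) (i : Fin (n + 1))
    (j : Fin i) :
    specHom α i (genericX D i j) =
      algebraMap K Ω (a (Fin.castLE (Nat.le_of_lt_succ i.isLt) j)) := by
  have h1 : specHom α i (MvPolynomial.rename (Fin.castLE j.isLt.le)
      (D (Fin.castLE (Nat.le_of_lt_succ i.isLt) j))) =
      specialize K D α (Fin.castLE (Nat.le_of_lt_succ i.isLt) j) := by
    rw [specHom, MvPolynomial.aeval_rename, specialize, MvPolynomial.aeval_def,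
      Subsingleton.elim (algebraMap (ZMod p) Ω) ((algebraMap K Ω).comp (ZMod.castHom dvd_rfl K))]
    rfl
  rw [genericX, map_sub, map_sub, map_pow, h1, specHom, MvPolynomial.aeval_X]
  linear_combination hα (Fin.castLE (Nat.le_of_lt_succ i.isLt) j)

theorem coe_specHom_towerGen [Fact p.Prime] [Algebra (ZMod p) Ω] [Algebra (ZMod p) (tower K α n)]
    (i : Fin (n + 1)) (s) :
    ((specHom (towerGen K α) i s : tower K α n) : Ω) = specHom (p := p) α i s := by
  have h : (algebraMap (tower K α n) Ω).comp (specHom (p := p) (towerGen K α) i).toRingHom =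
      (specHom (p := p) α i).toRingHom := by
    refine MvPolynomial.ringHom_ext' (Subsingleton.elim _ _) fun j => ?_
    change ((specHom (towerGen K α) i _ : tower K α n) : Ω) = specHom α i _
    rw [specHom, MvPolynomial.aeval_X, specHom, MvPolynomial.aeval_X]
    rfl
  exact DFunLike.congr_fun h s

/-- A K-endomorphism of Ω sends α_j to the specialization of the polynomial ρ(Y_j), which is a
polynomial in the α's and so lies in K_n. -/
theorem isGalois_tower [Fact p.Prime] [CharP K p] [IsSepClosure K Ω] {G : Type*} [Group G]
    {F : PFilteredGroup p n G} {D : (i : Fin n) → MvPolynomial (Fin i) (ZMod p)}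
    (hD : IsGenericFamily F D) {a : Fin n → K}
    (hα : ∀ i, α i ^ p - α i = specialize K D α i + algebraMap K Ω (a i)) :
    IsGalois K (tower K α n) := by
  have : CharP Ω p := charP_of_injective_algebraMap (algebraMap K Ω).injective p
  have : CharP (tower K α n) p :=
    charP_of_injective_algebraMap (algebraMap K (tower K α n)).injective p
  let _ : Algebra (ZMod p) Ω := ZMod.algebra Ω p
  let _ : Algebra (ZMod p) (tower K α n) := ZMod.algebra _ p
  have : Algebra.IsSeparable K (tower K α n) :=
    Algebra.isSeparable_tower_bot_of_isSeparable K (tower K α n) Ω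
  have : Normal K (tower K α n) := by
    rw [IntermediateField.normal_iff_forall_map_le]
    intro σ
    rw [tower, IntermediateField.adjoin_map, IntermediateField.adjoin_le_iff]
    rintro _ ⟨_, ⟨j, -, rfl⟩, rfl⟩
    obtain ⟨ρ, hρ⟩ := hD.exists_eq_specHom_comp α (Fin.last n)
      ((σ : Ω →+* Ω).comp (specHom (p := p) α (Fin.last n)).toRingHom) (by
        intro k
        change σ (specHom α _ _) = _
        rw [specHom_genericX D hα, AlgHom.commutes])
    have h1 := hρ (MvPolynomial.X j)
    rw [← coe_specHom_towerGen (K := K)] at h1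
    change σ (specHom α _ _) = _ at h1
    rw [specHom, MvPolynomial.aeval_X] at h1
    have h2 : σ (α j) ∈ tower K α n := by
      change σ (α (Fin.castLE le_rfl j)) ∈ _
      rw [h1]
      exact SetLike.coe_mem _
    exact h2
  exact ⟨⟩

/-- Elements of valuation k/p^m for 0 ≤ k < p^m have valuations distinct modulo ℤ = v(Kˣ), hence are
linearly independent over K. -/
theorem IsTotRamOfLevel.pow_le_finrank {v : AddValuation Ω (WithTop ℝ)} {m : ℕ} [hp : Fact p.Prime]
    {M : IntermediateField K Ω} [FiniteDimensional K M]
    (hbot : IsTotRamOfLevel v p 0 (⊥ : IntermediateField K Ω)) (h : IsTotRamOfLevel v p m M) :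
    p ^ m ≤ Module.finrank K M := by
  have hp0 : (0 : ℝ) < p ^ m := pow_pos (by exact_mod_cast hp.out.pos) m
  have hatt := fun k : Fin (p ^ m) => h.attained ((k : ℕ) : ℤ)
  choose x hx hxv using hatt
  have hli : LinearIndependent K (fun k => (⟨x k, hx k⟩ : M)) := by
    rw [Fintype.linearIndependent_iff]
    intro g hg
    by_contra! hne
    obtain ⟨k₀, hk₀⟩ := hne
    have hval : ∀ k, g k ≠ 0 → ∃ l : ℤ, v (algebraMap K Ω (g k) * x k) =
        ((l + ((k : ℕ) : ℤ) / p ^ m : ℝ) : WithTop ℝ) := by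
      intro k hk
      obtain ⟨l, hl⟩ := hbot.discrete _ (IntermediateField.algebraMap_mem _ (g k))
        (by simpa using hk)
      rw [pow_zero, div_one] at hl
      exact ⟨l, AddValuation.mul_eq_coe hl (hxv k)⟩
    refine AddValuation.sum_ne_zero_of_distinct (v := v) (t := Finset.univ)
      (f := fun k => algebraMap K Ω (g k) * x k) ?_ ⟨k₀, Finset.mem_univ _, ?_⟩ ?_
    · intro i _ j _ hij hi heq
      have hgi : g i ≠ 0 := by
        intro h'
        simp [h'] at hi
      have hgj : g j ≠ 0 := by
        intro h'
        simp only [h', map_zero, zero_mul, AddValuation.map_zero, v.top_iff] at heq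
        exact hi heq
      obtain ⟨k, hk⟩ := hval i hgi
      obtain ⟨l, hl⟩ := hval j hgj
      rw [hk, hl, WithTop.coe_inj] at heq
      field_simp at heq
      have h1 : k * (p : ℤ) ^ m + (i : ℕ) = (p : ℤ) ^ m * l + (j : ℕ) := by exact_mod_cast heq
      have h2 : ((p : ℤ) ^ m) ∣ ((i : ℕ) : ℤ) - (j : ℕ) := ⟨l - k, by linarith⟩
      have hi' : ((i : ℕ) : ℤ) < (p : ℤ) ^ m := by exact_mod_cast i.isLt
      have hj' : ((j : ℕ) : ℤ) < (p : ℤ) ^ m := by exact_mod_cast j.isLt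
      have h3 := Int.eq_zero_of_abs_lt_dvd h2 (by rw [abs_lt]; omega)
      exact hij (Fin.ext (by omega))
    · exact mul_ne_zero (by simpa using hk₀) (AddValuation.ne_zero_of_eq_coe (hxv k₀))
    · have h1 := congrArg (algebraMap M Ω) hg
      rw [map_sum, map_zero] at h1
      rw [← h1]
      refine Finset.sum_congr rfl fun k _ => ?_
      rw [Algebra.smul_def, map_mul, ← IsScalarTower.algebraMap_apply]
      rfl
  simpa using hli.fintype_card_le_finrank

/-- An automorphism mapped to 1 fixes all the α_j, so the homomorphism to G is injective; the degree
bound and |G| = p^n make it bijective. -/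
theorem exists_towerGal_mulEquiv [hp : Fact p.Prime] [CharP K p] [IsSepClosure K Ω] {G : Type*}
    [Group G] {F : PFilteredGroup p n G} {D : (i : Fin n) → MvPolynomial (Fin i) (ZMod p)}
    (hD : IsGenericFamily F D) {a : Fin n → K}
    (hα : ∀ i, α i ^ p - α i = specialize K D α i + algebraMap K Ω (a i))
    (hdeg : p ^ n ≤ Module.finrank K (tower K α n)) :
    ∃ μ : Gal(tower K α n/K) ≃* G,
      ∀ i : Fin (n + 1), (towerGal K α i).map μ.toMonoidHom = F.sub i := by
  have : CharP Ω p := charP_of_injective_algebraMap (algebraMap K Ω).injective p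
  have : CharP (tower K α n) p :=
    charP_of_injective_algebraMap (algebraMap K (tower K α n)).injective p
  let _ : Algebra (ZMod p) Ω := ZMod.algebra Ω p
  let _ : Algebra (ZMod p) (tower K α n) := ZMod.algebra _ p
  have : IsGalois K (tower K α n) := isGalois_tower hD hα
  obtain ⟨μ, hμ⟩ := hD.exists_monoidHom (K := K) (towerGen K α) (by
    intro i j
    refine ⟨a (Fin.castLE (Nat.le_of_lt_succ i.isLt) j), Subtype.ext ?_⟩
    rw [coe_specHom_towerGen, specHom_genericX D hα]
    rfl)
  have hμ' : ∀ (i : Fin (n + 1)) τ, μ τ ∈ F.sub i ↔ τ ∈ towerGal K α i := fun i τ =>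
    (hμ i τ).trans mem_towerGal_iff.symm
  have hcard : Nat.card G = p ^ n := by
    have h := F.card_sub 0
    rwa [F.sub_zero, Subgroup.card_top] at h
  have : Finite G := Nat.finite_of_card_ne_zero (by
    rw [hcard]
    exact pow_ne_zero _ hp.out.ne_zero)
  have hinj : Function.Injective μ := by
    rw [injective_iff_map_eq_one]
    intro τ hτ
    refine eq_one_of_fixes_towerGen fun j => ?_
    refine (hμ (Fin.last n) τ).mp ?_ j j.isLt
    rw [hτ]
    exact one_mem _
  have hbij : Function.Bijective μ := hinj.bijective_of_nat_card_le (by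
    rwa [hcard, IsGalois.card_aut_eq_finrank])
  refine ⟨MulEquiv.ofBijective μ hbij, fun i => ?_⟩
  ext g
  obtain ⟨τ, rfl⟩ := hbij.2 g
  rw [hμ']
  constructor
  · rintro ⟨τ', hτ', h⟩
    rwa [← hinj h]
  · exact fun h => ⟨τ, h, rfl⟩

end TowerGalois

/-! ### Lower ramification groups -/

section LowerRam

variable {p n : ℕ} [hp : Fact p.Prime] {K : Type*} [Field K] [Valued K ℤᵐ⁰]
  [IsLocalFieldPerfectResidue K] {Ω : Type*} [Field Ω] [Algebra K Ω] [Algebra.IsAlgebraic K Ω]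

/-- Along k ↦ k/p^m the two value groups correspond to ℤ and p^m ℤ. -/
theorem IsTotRamOfLevel.ramIndex_eq {m : ℕ} {M : IntermediateField K Ω}
    (h : IsTotRamOfLevel (extVal K (Ω := Ω)) p m M) : ramIndex M = p ^ m := by
  have hp0 : (p : ℝ) ^ m ≠ 0 := pow_ne_zero _ (by exact_mod_cast hp.out.ne_zero)
  let f : ℤ →+ ℝ := (AddMonoidHom.mulRight ((p : ℝ) ^ m)⁻¹).comp (Int.castAddHom ℝ)
  have hf : ∀ k, f k = k / (p : ℝ) ^ m := fun k => (div_eq_mul_inv _ _).symm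
  have hinj : Function.Injective f := by
    intro k l hkl
    rw [hf, hf, div_left_inj' hp0] at hkl
    exact_mod_cast hkl
  have hM : valueGroupOf M = AddSubgroup.map f ⊤ := by
    ext r
    constructor
    · rintro ⟨x, hx, hxr⟩
      obtain ⟨k, hk⟩ := h.discrete x hx (AddValuation.ne_zero_of_eq_coe hxr)
      rw [hxr, WithTop.coe_inj] at hk
      exact ⟨k, trivial, by rw [hf, hk]⟩
    · rintro ⟨k, -, rfl⟩
      obtain ⟨x, hx, hxk⟩ := h.attained k
      exact ⟨x, hx, by rw [hxk, hf]⟩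
  have hbot : valueGroupOf (⊥ : IntermediateField K Ω) =
      AddSubgroup.map f (AddSubgroup.zmultiples ((p : ℤ) ^ m)) := by
    have h0 := isTotRamOfLevel_bot (K := K) (Ω := Ω) p
    ext r
    constructor
    · rintro ⟨x, hx, hxr⟩
      obtain ⟨k, hk⟩ := h0.discrete x hx (AddValuation.ne_zero_of_eq_coe hxr)
      rw [hxr, WithTop.coe_inj, pow_zero, div_one] at hk
      refine ⟨k * (p : ℤ) ^ m, ⟨k, by simp⟩, ?_⟩
      rw [hf, hk]
      push_cast
      field_simp
    · rintro ⟨_, ⟨k, rfl⟩, rfl⟩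
      obtain ⟨x, hx, hxk⟩ := h0.attained k
      refine ⟨x, hx, ?_⟩
      rw [hxk, hf]
      congr 1
      simp only [smul_eq_mul]
      push_cast
      field_simp
  rw [ramIndex, hM, hbot, AddSubgroup.relIndex_map_map_of_injective _ _ hinj,
    AddSubgroup.relIndex_top_right, Int.index_zmultiples, Int.natAbs_pow, Int.natAbs_natCast]

theorem le_normVal_iff {m : ℕ} {M : IntermediateField K Ω}
    (h : IsTotRamOfLevel (extVal K (Ω := Ω)) p m M) {s : ℝ} {x : Ω} :
    (s : WithTop ℝ) ≤ normVal M x ↔ ((s / p ^ m : ℝ) : WithTop ℝ) ≤ extVal K x := by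
  have hp0 : (0 : ℝ) < p ^ m := pow_pos (by exact_mod_cast hp.out.pos) m
  rw [normVal, h.ramIndex_eq]
  cases extVal K x with
  | top => simp
  | coe r =>
    rw [WithTop.map_coe, WithTop.coe_le_coe, WithTop.coe_le_coe, div_le_iff₀ hp0]
    push_cast
    rw [mul_comm]

end LowerRam

/-! ### Lower ramification numbers in the tower -/

section LowerRamTower

variable {p n : ℕ} [hp : Fact p.Prime] {K : Type*} [Field K] [Valued K ℤᵐ⁰]
  [IsLocalFieldPerfectResidue K] {Ω : Type*} [Field Ω] [Algebra K Ω] [Normal K Ω] [CharP Ω p]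
  {α : Fin n → Ω} {u : Fin n → ℕ} {b : Fin n → ℤ}

/-- The lower ramification number of an automorphism that first moves the generator `α_i`. -/
theorem mem_lowerRam_iff
    (h : IsReducedTower (K := K) (extVal K (Ω := Ω)) p α b) (hb : IsBreakSeq p u b)
    {τ : Gal(tower K α n/K)} {i : Fin n}
    (hfix : ∀ j < i, τ (towerGen K α j) = towerGen K α j)
    (hmove : τ (towerGen K α i) ≠ towerGen K α i) {t : ℝ} :
    τ ∈ lowerRam (tower K α n) t ↔ t ≤ b i := by
  have hlev := h.level n le_rfl
  have hp0 : (0 : ℝ) < p ^ n := pow_pos (by exact_mod_cast hp.out.pos) n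
  obtain ⟨σ, hσ⟩ := exists_algHom_extending τ
  have hdis := h.displacesBy hb (exists_extVal_algebraMap_eq (K := K) Ω) (σ := σ)
    (extVal_algHom σ) (i := i) (fun j hj => by
      have h1 := hσ (towerGen K α j)
      rw [hfix j hj] at h1
      exact h1) (fun h1 => by
      have h2 := hσ (towerGen K α i)
      refine hmove (towerGen_fixed_iff.mpr ?_)
      rw [← h2]
      exact h1) n i.isLt le_rfl
  constructor
  · intro hτ
    -- A uniformizer has normalised valuation 1, prime to p, so the displacement is attained: it
    -- moves by valuation exactly 1 + b_i.
    obtain ⟨x, hx, hx1⟩ := hlev.attained 1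
    have h1 := hτ ⟨x, hx⟩ (by
      change 0 ≤ extVal K x
      rw [hx1]
      exact_mod_cast (by positivity : (0 : ℝ) ≤ (1 : ℤ) / p ^ n))
    rw [← hσ, le_normVal_iff hlev] at h1
    change _ ≤ extVal K (σ x - x) at h1
    rw [hdis.eq x hx 1 (by
        intro hdvd
        have := Int.le_of_dvd one_pos hdvd
        have := hp.out.one_lt
        omega) hx1, WithTop.coe_le_coe, ← add_div, div_le_div_iff_of_pos_right hp0] at h1
    push_cast at h1
    linarith
  · intro ht x hx0
    rw [← hσ, le_normVal_iff hlev]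
    have key : ∀ y ∈ tower K α n, 0 < extVal K y →
        (((t + 1) / p ^ n : ℝ) : WithTop ℝ) ≤ extVal K (σ y - y) := by
      intro y hy hy0
      rcases eq_or_ne y 0 with rfl | hne
      · simp
      obtain ⟨r, hr⟩ := (extVal K (Ω := Ω)).exists_eq_coe hne
      have h1 := hlev.add_one_le (k := 0) hy hne (by simpa using hy0)
      rw [hr, WithTop.coe_le_coe] at h1
      refine le_trans ?_ (hdis.le y hy r hr)
      rw [WithTop.coe_le_coe, add_comm t, add_div]
      have h2 : t / (p : ℝ) ^ n ≤ b i / p ^ n := by gcongr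
      push_cast at h1
      rw [zero_add] at h1
      linarith
    rcases hx0.lt_or_eq with hlt | heq
    · exact key x x.2 hlt
    · obtain ⟨c, hc⟩ := hlev.residue x x.2 heq.symm
      have h1 := key _ ((tower K α n).sub_mem x.2 ((tower K α n).algebraMap_mem c)) hc
      rw [map_sub σ, AlgHom.commutes, sub_sub_sub_cancel_right] at h1
      exact h1

/-- Let α_k be the first generator moved by τ ≠ 1. Membership means t ≤ b_k on one side and i ≤ k on
the other, and the position of t among the breaks makes these equivalent. -/
theorem lowerRam_eq_towerGal
    (h : IsReducedTower (K := K) (extVal K (Ω := Ω)) p α b) (hb : IsBreakSeq p u b)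
    {i : ℕ} {t : ℝ} (hlt : ∀ j : Fin n, (j : ℕ) < i → (b j : ℝ) < t)
    (hge : ∀ j : Fin n, i ≤ j → t ≤ b j) :
    lowerRam (tower K α n) t = towerGal K α i := by
  ext τ
  by_cases hall : ∀ j : Fin n, τ (towerGen K α j) = towerGen K α j
  · rw [eq_one_of_fixes_towerGen hall]
    simp [one_mem]
  · push Not at hall
    obtain ⟨k, hk, hmin⟩ := WellFounded.has_min (wellFounded_lt (α := Fin n))
      {j | τ (towerGen K α j) ≠ towerGen K α j} hall
    have hfix : ∀ j < k, τ (towerGen K α j) = towerGen K α j := by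
      intro j hj
      by_contra hne
      exact hmin j hne hj
    rw [mem_lowerRam_iff h hb hfix hk, mem_towerGal_iff]
    constructor
    · intro ht j hj
      refine hfix j ?_
      by_contra hkj
      exact absurd ht (not_le.mpr (hlt k (lt_of_le_of_lt (not_lt.mp hkj) hj)))
    · intro hfix'
      refine hge k ?_
      by_contra hki
      exact hk (hfix' k (not_le.mp hki))

end LowerRamTower

/-! ### Filtrations with given jumps -/

theorem exists_jump_index {n : ℕ} {c : Fin n → ℝ} (hc : StrictMono c) (t : ℝ) :
    ∃ i ≤ n, (∀ j : Fin n, (j : ℕ) < i → c j < t) ∧ ∀ j : Fin n, i ≤ j → t ≤ c j := by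
  classical
  have hex : ∃ i, ∀ j : Fin n, i ≤ (j : ℕ) → t ≤ c j := ⟨n, fun j hj => absurd j.isLt hj.not_gt⟩
  refine ⟨Nat.find hex, Nat.find_min' hex fun j hj => absurd j.isLt hj.not_gt, fun j hj => ?_,
    Nat.find_spec hex⟩
  by_contra hge
  exact Nat.find_min hex hj fun k hk => (not_lt.mp hge).trans (hc.monotone hk)

section Jumps

variable {S : Type*} {n : ℕ} {c : Fin n → ℝ} {H : ℝ → S} {T : Fin (n + 1) → S}

/-- The filtration is constant between consecutive breaks, right endpoint included, so the change at
c_i shows immediately to its right; injectivity of T makes it a genuine change. -/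
theorem setOf_jumps_eq_range (hc : StrictMono c) (hc0 : ∀ i, -1 ≤ c i)
    (hT : Function.Injective T)
    (hH : ∀ (i : Fin (n + 1)) (t : ℝ), -1 ≤ t → (∀ j : Fin n, (j : ℕ) < i → c j < t) →
      (∀ j : Fin n, (i : ℕ) ≤ j → t ≤ c j) → H t = T i) :
    {x : ℝ | -1 ≤ x ∧ ∀ ε > 0, H x ≠ H (x + ε)} = Set.range c := by
  ext x
  constructor
  · rintro ⟨hx, hjump⟩
    obtain ⟨i, hin, h1, h2⟩ := exists_jump_index hc x
    by_contra hnot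
    have hlt : ∀ j : Fin n, i ≤ j → x < c j := fun j hj =>
      lt_of_le_of_ne (h2 j hj) fun h => hnot ⟨j, h.symm⟩
    -- The distance to the next break, or 1 when none remains.
    obtain ⟨ε, hε, hle⟩ : ∃ ε > 0, ∀ j : Fin n, i ≤ j → x + ε ≤ c j := by
      by_cases hi : i < n
      · refine ⟨c ⟨i, hi⟩ - x, sub_pos.mpr (hlt ⟨i, hi⟩ le_rfl), fun j hj => ?_⟩
        rw [add_sub_cancel]
        exact hc.monotone hj
      · exact ⟨1, one_pos, fun j hj => absurd (lt_of_le_of_lt hj j.isLt) hi⟩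
    refine hjump ε hε ?_
    rw [hH ⟨i, Nat.lt_succ_of_le hin⟩ x hx h1 h2,
      hH ⟨i, Nat.lt_succ_of_le hin⟩ (x + ε) (by linarith)
        (fun j hj => (h1 j hj).trans (by linarith)) hle]
  · rintro ⟨i, rfl⟩
    refine ⟨hc0 i, fun ε hε heq => ?_⟩
    obtain ⟨k, hkn, h1, h2⟩ := exists_jump_index hc (c i + ε)
    rw [hH i.castSucc (c i) (hc0 i) (fun j hj => hc hj) (fun j hj => hc.monotone hj),
      hH ⟨k, Nat.lt_succ_of_le hkn⟩ (c i + ε) (by linarith [hc0 i]) h1 h2] at heq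
    have h3 : (i : ℕ) = k := congrArg Fin.val (hT heq)
    have h4 := h2 i h3.ge
    linarith

/-- For i < n the value T_i is taken at the break c_i itself, and T_n beyond all breaks. -/
theorem setOf_values_eq_range (hc : StrictMono c) (hc0 : ∀ i, -1 ≤ c i)
    (hH : ∀ (i : Fin (n + 1)) (t : ℝ), -1 ≤ t → (∀ j : Fin n, (j : ℕ) < i → c j < t) →
      (∀ j : Fin n, (i : ℕ) ≤ j → t ≤ c j) → H t = T i) :
    {s | ∃ t : ℝ, -1 ≤ t ∧ s = H t} = Set.range T := by
  ext s
  constructor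
  · rintro ⟨t, ht, rfl⟩
    obtain ⟨i, hin, h1, h2⟩ := exists_jump_index hc t
    exact ⟨⟨i, Nat.lt_succ_of_le hin⟩, (hH ⟨i, Nat.lt_succ_of_le hin⟩ t ht h1 h2).symm⟩
  · rintro ⟨i, rfl⟩
    induction i using Fin.lastCases with
    | cast i =>
      exact ⟨c i, hc0 i, (hH i.castSucc (c i) (hc0 i) (fun j hj => hc hj)
        fun j hj => hc.monotone hj).symm⟩
    | last =>
      obtain ⟨B, hB, hB0⟩ : ∃ B : ℝ, (∀ j, c j < B) ∧ -1 ≤ B := by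
        obtain ⟨B, hB⟩ := (Set.finite_range c).bddAbove
        refine ⟨max B 0 + 1, fun j => ?_, by linarith [le_max_right B 0]⟩
        have := hB ⟨j, rfl⟩
        linarith [le_max_left B 0]
      exact ⟨B, hB0, (hH (Fin.last n) B hB0 (fun j _ => hB j)
        fun j hj => absurd j.isLt (not_lt.mpr hj)).symm⟩

end Jumps

/-! ### Upper ramification groups -/

section Herbrand

variable {K : Type*} [Field K] [Valued K ℤᵐ⁰] [IsLocalFieldPerfectResidue K]
  {Ω : Type*} [Field Ω] [Algebra K Ω] [Algebra.IsAlgebraic K Ω] {L : IntermediateField K Ω}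

theorem lowerRam_antitone : Antitone (lowerRam L) := by
  intro s t hst σ hσ x hx
  refine le_trans ?_ (hσ x hx)
  exact WithTop.coe_le_coe.mpr (by linarith)

variable [Finite Gal(L/K)]

theorem herbrand_integrand_pos (t : ℝ) :
    0 < 1 / (((lowerRam L t).relIndex (lowerRam L 0) : ℕ) : ℝ) := by
  have h : (lowerRam L t).relIndex (lowerRam L 0) ≠ 0 := Subgroup.index_ne_zero_of_finite
  have h' : (0 : ℝ) < ((lowerRam L t).relIndex (lowerRam L 0) : ℕ) := by
    exact_mod_cast Nat.pos_of_ne_zero h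
  positivity

theorem herbrand_integrand_antitone :
    Antitone fun t : ℝ => 1 / (((lowerRam L t).relIndex (lowerRam L 0) : ℕ) : ℝ) := by
  intro s t hst
  have h1 : (lowerRam L t).relIndex (lowerRam L 0) ≠ 0 := Subgroup.index_ne_zero_of_finite
  have h2 : (lowerRam L s).relIndex (lowerRam L 0) ≤ (lowerRam L t).relIndex (lowerRam L 0) :=
    Subgroup.relIndex_le_of_le_left (lowerRam_antitone hst) h1
  have h3 : (0 : ℝ) < ((lowerRam L s).relIndex (lowerRam L 0) : ℕ) := by
    exact_mod_cast Nat.pos_of_ne_zero Subgroup.index_ne_zero_of_finite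
  exact one_div_le_one_div_of_le h3 (by exact_mod_cast h2)

theorem herbrand_integrable (x y : ℝ) :
    IntervalIntegrable (fun t : ℝ => 1 / (((lowerRam L t).relIndex (lowerRam L 0) : ℕ) : ℝ))
      MeasureTheory.volume x y :=
  herbrand_integrand_antitone.intervalIntegrable

theorem herbrandPhi_sub (x y : ℝ) :
    herbrandPhi L y - herbrandPhi L x =
      ∫ t in x..y, 1 / (((lowerRam L t).relIndex (lowerRam L 0) : ℕ) : ℝ) :=
  intervalIntegral.integral_interval_sub_left (herbrand_integrable 0 y) (herbrand_integrable 0 x)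

theorem herbrandPhi_strictMono : StrictMono (herbrandPhi L) := by
  intro x y hxy
  rw [← sub_pos, herbrandPhi_sub]
  exact intervalIntegral.intervalIntegral_pos_of_pos_on (herbrand_integrable x y)
    (fun t _ => herbrand_integrand_pos t) hxy

theorem herbrandPhi_continuous : Continuous (herbrandPhi L) :=
  intervalIntegral.continuous_primitive herbrand_integrable 0

/-- The increments of `φ` on an interval where the lower ramification groups are constant. -/
theorem herbrandPhi_sub_of_const {x y : ℝ} (hxy : x ≤ y) {k : ℕ}
    (h : ∀ t, x < t → t ≤ y → (lowerRam L t).relIndex (lowerRam L 0) = k) :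
    herbrandPhi L y - herbrandPhi L x = (y - x) / k := by
  rw [herbrandPhi_sub, intervalIntegral.integral_congr_ae (g := fun _ => 1 / (k : ℝ)),
    intervalIntegral.integral_const, smul_eq_mul, mul_one_div]
  refine Filter.Eventually.of_forall fun t ht => ?_
  rw [Set.uIoc_of_le hxy] at ht
  rw [h t ht.1 ht.2]

theorem le_herbrandPhi {x : ℝ} (hx : 0 ≤ x) : x / Nat.card Gal(L/K) ≤ herbrandPhi L x := by
  have h1 : (∫ _ in (0 : ℝ)..x, 1 / (Nat.card Gal(L/K) : ℝ)) ≤ herbrandPhi L x := by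
    refine intervalIntegral.integral_mono_on hx (by simp) (herbrand_integrable 0 x) fun t _ => ?_
    have h2 : (lowerRam L t).relIndex (lowerRam L 0) ≤ Nat.card Gal(L/K) :=
      (Nat.le_of_dvd Nat.card_pos (Subgroup.index_dvd_card _)).trans
        (Nat.le_of_dvd Nat.card_pos (Subgroup.card_subgroup_dvd_card _))
    have h3 : (0 : ℝ) < ((lowerRam L t).relIndex (lowerRam L 0) : ℕ) := by
      exact_mod_cast Nat.pos_of_ne_zero Subgroup.index_ne_zero_of_finite
    exact one_div_le_one_div_of_le h3 (by exact_mod_cast h2)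
  rwa [intervalIntegral.integral_const, smul_eq_mul, mul_one_div, sub_zero] at h1

/-- The intermediate value theorem on [-1, B]: the integrand of φ is at least 1/|Gal(L/K)|, so B =
max(x, 0) · |Gal(L/K)| is large enough. -/
theorem herbrandPsi_spec (h0 : herbrandPhi L (-1) = -1) {x : ℝ} (hx : -1 ≤ x) :
    -1 ≤ herbrandPsi L x ∧ herbrandPhi L (herbrandPsi L x) = x := by
  have hex : ∃ y ∈ Set.Ici (-1 : ℝ), herbrandPhi L y = x := by
    have hc : (0 : ℝ) < Nat.card Gal(L/K) := by exact_mod_cast Nat.card_pos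
    set B : ℝ := max x 0 * Nat.card Gal(L/K) with hB
    have hB0 : 0 ≤ B := by positivity
    have h1 : x ≤ herbrandPhi L B := by
      refine le_trans ?_ (le_herbrandPhi hB0)
      rw [hB, mul_div_cancel_right₀ _ hc.ne']
      exact le_max_left _ _
    obtain ⟨y, hy, hyx⟩ := intermediate_value_Icc (by linarith : (-1 : ℝ) ≤ B)
      herbrandPhi_continuous.continuousOn ⟨by rwa [h0], h1⟩
    exact ⟨y, hy.1, hyx⟩
  exact ⟨Function.invFunOn_mem hex, Function.invFunOn_eq hex⟩

end Herbrand

/-! ### The Herbrand function of the tower and the upper numbering -/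

section UpperRam

variable {p n : ℕ} [hp : Fact p.Prime] {K : Type*} [Field K] [Valued K ℤᵐ⁰]
  [IsLocalFieldPerfectResidue K] {Ω : Type*} [Field Ω] [Algebra K Ω] [Normal K Ω] [CharP Ω p]
  {α : Fin n → Ω} {u : Fin n → ℕ} {b : Fin n → ℤ}

theorem relIndex_lowerRam (h : IsReducedTower (K := K) (extVal K (Ω := Ω)) p α b)
    (hb : IsBreakSeq p u b) (hindex : ∀ i ≤ n, (towerGal K α i).index = p ^ i)
    {i : ℕ} (hi : i ≤ n) {t : ℝ} (hlt : ∀ j : Fin n, (j : ℕ) < i → (b j : ℝ) < t)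
    (hge : ∀ j : Fin n, i ≤ j → t ≤ b j) :
    (lowerRam (tower K α n) t).relIndex (lowerRam (tower K α n) 0) = p ^ i := by
  have h0 : lowerRam (tower K α n) 0 = ⊤ := by
    rw [lowerRam_eq_towerGal h hb (i := 0) (fun j hj => absurd hj (Nat.not_lt_zero _))
      (fun j _ => by exact_mod_cast (hb.lower_pos j).le), ← Subgroup.index_eq_one,
      hindex 0 (Nat.zero_le _), pow_zero]
  rw [h0, Subgroup.relIndex_top_right, lowerRam_eq_towerGal h hb hlt hge, hindex i hi]

/-- Between b_i and b_{i+1} the index is p^(i+1), so φ grows by (b_{i+1} - b_i)/p^(i+1) = u_{i+1} -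
u_i; before b_0 its slope is 1. -/
theorem herbrandPhi_lower_break (h : IsReducedTower (K := K) (extVal K (Ω := Ω)) p α b)
    (hb : IsBreakSeq p u b) (hindex : ∀ i ≤ n, (towerGal K α i).index = p ^ i) (i : Fin n) :
    herbrandPhi (tower K α n) (b i) = u i := by
  have hp0 : (p : ℝ) ≠ 0 := by exact_mod_cast hp.out.ne_zero
  obtain ⟨i, hi⟩ := i
  induction i with
  | zero =>
    have hb0 : (0 : ℝ) ≤ b ⟨0, hi⟩ := by exact_mod_cast (hb.lower_pos ⟨0, hi⟩).le
    have h1 := herbrandPhi_sub_of_const (L := tower K α n) hb0 (k := p ^ 0) fun t _ ht =>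
      relIndex_lowerRam h hb hindex (Nat.zero_le n) (fun j hj => absurd hj (Nat.not_lt_zero _))
        (fun j _ => ht.trans (by exact_mod_cast hb.lower_strictMono.monotone (Nat.zero_le _)))
    have h2 : herbrandPhi (tower K α n) 0 = 0 := intervalIntegral.integral_same
    rw [h2, sub_zero, sub_zero, hb.zero hi] at h1
    rw [hb.zero hi, h1]
    simp
  | succ i ih =>
    have hle : (b ⟨i, Nat.lt_of_succ_lt hi⟩ : ℝ) ≤ b ⟨i + 1, hi⟩ := by
      exact_mod_cast (hb.lt_succ i hi).le
    have h1 := herbrandPhi_sub_of_const (L := tower K α n) hle (k := p ^ (i + 1))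
      fun t ht1 ht2 => relIndex_lowerRam h hb hindex hi.le
        (fun j hj => lt_of_le_of_lt
          (by exact_mod_cast hb.lower_strictMono.monotone (Nat.le_of_lt_succ hj)) ht1)
        (fun j hj => ht2.trans (by exact_mod_cast hb.lower_strictMono.monotone hj))
    have h2 : (b ⟨i + 1, hi⟩ - b ⟨i, Nat.lt_of_succ_lt hi⟩ : ℝ) =
        (p : ℝ) ^ (i + 1) * (u ⟨i + 1, hi⟩ - u ⟨i, Nat.lt_of_succ_lt hi⟩) := by
      exact_mod_cast hb.succ i hi
    rw [h2, ih, Nat.cast_pow, mul_div_cancel_left₀ _ (pow_ne_zero _ hp0)] at h1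
    linarith

/-- All breaks are positive, so φ has slope 1 on [-1, 0]. -/
theorem herbrandPhi_neg_one (h : IsReducedTower (K := K) (extVal K (Ω := Ω)) p α b)
    (hb : IsBreakSeq p u b) (hindex : ∀ i ≤ n, (towerGal K α i).index = p ^ i) :
    herbrandPhi (tower K α n) (-1) = -1 := by
  have h1 := herbrandPhi_sub_of_const (L := tower K α n) (by norm_num : (-1 : ℝ) ≤ 0) (k := p ^ 0)
    fun t _ ht => relIndex_lowerRam h hb hindex (Nat.zero_le n)
      (fun j hj => absurd hj (Nat.not_lt_zero _))
      (fun j _ => ht.trans (by exact_mod_cast (hb.lower_pos j).le))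
  have h2 : herbrandPhi (tower K α n) 0 = 0 := intervalIntegral.integral_same
  rw [h2] at h1
  norm_num at h1
  linarith

/-- As φ is strictly increasing with φ(b_j) = u_j, comparing ψ(x) with b_j amounts to comparing x
with u_j. -/
theorem upperRam_eq_towerGal (h : IsReducedTower (K := K) (extVal K (Ω := Ω)) p α b)
    (hb : IsBreakSeq p u b) (hindex : ∀ i ≤ n, (towerGal K α i).index = p ^ i) {i : ℕ} {x : ℝ}
    (hx : -1 ≤ x) (hlt : ∀ j : Fin n, (j : ℕ) < i → (u j : ℝ) < x)
    (hge : ∀ j : Fin n, i ≤ j → x ≤ u j) :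
    upperRam (tower K α n) x = towerGal K α i := by
  obtain ⟨-, h1⟩ := herbrandPsi_spec (herbrandPhi_neg_one h hb hindex) hx
  refine lowerRam_eq_towerGal h hb (fun j hj => ?_) fun j hj => ?_
  · rw [← (herbrandPhi_strictMono (L := tower K α n)).lt_iff_lt, h1, herbrandPhi_lower_break h hb hindex]
    exact hlt j hj
  · rw [← (herbrandPhi_strictMono (L := tower K α n)).le_iff_le, h1, herbrandPhi_lower_break h hb hindex]
    exact hge j hj

end UpperRam

/-! ### The main theorem -/

theorem mainTheorem6 {p n : ℕ} [Fact p.Prime] {G : Type*} [Group G] (F : PFilteredGroup p n G)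
    (D : (i : Fin n) → MvPolynomial (Fin i) (ZMod p)) (hD : IsGenericFamily F D)
    {K : Type*} [Field K] [Valued K ℤᵐ⁰] [IsLocalFieldPerfectResidue K] [CharP K p]
    {Ω : Type*} [Field Ω] [Algebra K Ω] [IsSepClosure K Ω]
    (u : Fin n → ℕ) (hu_mono : StrictMono u) (hu_pos : ∀ i, 0 < u i) (hu_p : ∀ i, ¬ p ∣ u i)
    (a : Fin n → K) (ha : ∀ i, extVal K (algebraMap K Ω (a i)) = ((-(u i : ℝ) : ℝ) : WithTop ℝ))
    (α : Fin n → Ω) (hα : ∀ i, α i ^ p - α i = specialize K D α i + algebraMap K Ω (a i))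
    (b : Fin n → ℤ) (hb_zero : ∀ h : 0 < n, b ⟨0, h⟩ = u ⟨0, h⟩)
    (hb_succ : ∀ (i : ℕ) (h : i + 1 < n),
      b ⟨i + 1, h⟩ - b ⟨i, Nat.lt_of_succ_lt h⟩ =
        (p : ℤ) ^ (i + 1) * ((u ⟨i + 1, h⟩ : ℤ) - u ⟨i, Nat.lt_of_succ_lt h⟩))
    (hb : ∀ i ∉ F.splitIndices,
      ((-((b i : ℝ) / (p : ℝ) ^ (i : ℕ)) : ℝ) : WithTop ℝ) < extVal K (specialize K D α i)) :
    (IsGalois K (tower K α n) ∧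
      ∃ μ : Gal(tower K α n/K) ≃* G,
        ∀ i : Fin (n + 1), (towerGal K α i).map μ.toMonoidHom = F.sub i) ∧
    ({x : ℝ | IsUpperBreak (tower K α n) x} = Set.range (fun i => (u i : ℝ)) ∧
      {x : ℝ | IsLowerBreak (tower K α n) x} = Set.range (fun i => (b i : ℝ)) ∧
      ∀ i, extVal K (α i) = ((-((u i : ℝ) / p) : ℝ) : WithTop ℝ)) ∧
    ({H : Subgroup Gal(tower K α n/K) | ∃ t : ℝ, -1 ≤ t ∧ H = lowerRam (tower K α n) t} =
        Set.range (fun i : Fin (n + 1) => towerGal K α i) ∧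
      {H : Subgroup Gal(tower K α n/K) | ∃ x : ℝ, -1 ≤ x ∧ H = upperRam (tower K α n) x} =
        Set.range (fun i : Fin (n + 1) => towerGal K α i)) := by
  have hp : p.Prime := Fact.out
  have : CharP Ω p := charP_of_injective_algebraMap (algebraMap K Ω).injective p
  have hbs : IsBreakSeq p u b := ⟨hu_mono, hu_pos, hu_p, hb_zero, hb_succ⟩
  have hd : ∀ i, ((-((b i : ℝ) / (p : ℝ) ^ (i : ℕ)) : ℝ) : WithTop ℝ) <
      extVal K (specialize K D α i) := by
    intro i
    -- At split indices d_i = 0 has valuation ⊤, so the bound on v(d_i) holds for every i.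
    by_cases hi : i ∈ F.splitIndices
    · have h0 : specialize K D α i = 0 := by
        rw [specialize, hD.eq_zero i hi, MvPolynomial.eval₂_zero]
      rw [h0, AddValuation.map_zero]
      exact WithTop.coe_lt_top _
    · exact hb i hi
  have hred : IsReducedTower (K := K) (extVal K (Ω := Ω)) p α b :=
    isReducedTower hbs (isTotRamOfLevel_bot p) exists_extVal_sub_pow_pos ha
      (specialize_mem_tower D) hd hα
  have hgal : IsGalois K (tower K α n) := isGalois_tower hD hα
  obtain ⟨μ, hμ⟩ := exists_towerGal_mulEquiv hD hα
    ((isTotRamOfLevel_bot p).pow_le_finrank (hred.level n le_rfl))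
  have hcard : Nat.card G = p ^ n := by
    have h := F.card_sub 0
    rwa [F.sub_zero, Subgroup.card_top] at h
  have hindex : ∀ i ≤ n, (towerGal K α i).index = p ^ i := by
    intro i hi
    have h1 : (F.sub ⟨i, Nat.lt_succ_of_le hi⟩).index = (towerGal K α i).index := by
      rw [← hμ]
      exact Subgroup.index_map_equiv _ μ
    have h2 := Subgroup.card_mul_index (F.sub ⟨i, Nat.lt_succ_of_le hi⟩)
    rw [F.card_sub, hcard, h1] at h2
    refine Nat.eq_of_mul_eq_mul_left (pow_pos hp.pos (n - i)) (h2.trans ?_)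
    rw [← pow_add, Nat.sub_add_cancel hi]
  have hinj : Function.Injective fun i : Fin (n + 1) => towerGal K α i := by
    intro i j hij
    refine F.strictAnti.injective ?_
    rw [← hμ, ← hμ]
    exact congrArg (Subgroup.map μ.toMonoidHom) hij
  have hu_mono' : StrictMono fun i => (u i : ℝ) := fun i j hij => Nat.cast_lt.mpr (hu_mono hij)
  have hb_mono' : StrictMono fun i => (b i : ℝ) := fun i j hij =>
    Int.cast_lt.mpr (hbs.lower_strictMono hij)
  have hu0 : ∀ i, (-1 : ℝ) ≤ u i := fun i => le_trans (by norm_num) (Nat.cast_nonneg (u i))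
  have hb0 : ∀ i, (-1 : ℝ) ≤ b i := fun i =>
    le_trans (by norm_num) (by exact_mod_cast (hbs.lower_pos i).le : (0 : ℝ) ≤ b i)
  have hlower : ∀ (i : Fin (n + 1)) (t : ℝ), -1 ≤ t → (∀ j : Fin n, (j : ℕ) < i → (b j : ℝ) < t) →
      (∀ j : Fin n, (i : ℕ) ≤ j → t ≤ b j) → lowerRam (tower K α n) t = towerGal K α i :=
    fun _ _ _ h1 h2 => lowerRam_eq_towerGal hred hbs h1 h2
  have hupper : ∀ (i : Fin (n + 1)) (t : ℝ), -1 ≤ t → (∀ j : Fin n, (j : ℕ) < i → (u j : ℝ) < t) →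
      (∀ j : Fin n, (i : ℕ) ≤ j → t ≤ u j) → upperRam (tower K α n) t = towerGal K α i :=
    fun _ _ h0 h1 h2 => upperRam_eq_towerGal hred hbs hindex h0 h1 h2
  exact ⟨⟨hgal, μ, hμ⟩,
    ⟨setOf_jumps_eq_range hu_mono' hu0 hinj hupper, setOf_jumps_eq_range hb_mono' hb0 hinj hlower,
      fun i => val_generator hbs (ha i) (hd i) (hα i)⟩,
    setOf_values_eq_range hb_mono' hb0 hlower, setOf_values_eq_range hu_mono' hu0 hupper⟩
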